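/- Let $N\ge 1$, let $\Omega\subset\mathbb{R}^N$ be an open set (bounded or not), $T>0$, $\Omega_T:=\Omega\times(0,T)$, $\alpha\in(0,1)$, $\mathbf p=(p_1,\dots,p_N)$ with $p_i>1$ for all $i$, $P:=\max\{\alpha+1,p_1,\dots,p_N\}$ and $\Lambda>0$. Let $A:\Omega_T\times\mathbb{R}\times\mathbb{R}^N\to\mathbb{R}^N$ be a Carathéodory vector field (measurable in $(x,t)$ for all $(s,\xi)$, continuous in $(s,\xi)$ for a.e. $(x,t)$) such that for a.e. $(x,t)\in\Omega_T$ and all $(s,\xi)\in\mathbb{R}\times\mathbb{R}^N$ \[ A(x,t,s,\xi)\cdot\xi\ \ge\ \Lambda^{-1}\sum_{i=1}^N|\xi_i|^{p_i},\qquad |A_i(x,t,s,\xi)|\ \le\ \Lambda\Big(\sum_{k=1}^N|\xi_k|^{p_k}\Big)^{\frac{p_i-1}{p_i}},\quad i=1,\dots,N. \] Let $u$ be a weak solution of $\partial_t(|u|^{\alpha-1}u)-\nabla\cdot A(x,t,u,\nabla u)=0$ in $\Omega_T$, that is: $u\in L^1(0,T;W^{1,1}_{\rm loc}(\Omega))$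 with spatial weak derivatives $\partial_iu\in L^{p_i}(0,T;L^{p_i}_{\rm loc}(\Omega))$ for every $i$, $u\in L^P(0,T;L^P_{\rm loc}(\Omega))$, and \[ \iint_{\Omega_T}\Big(A(x,t,u,\nabla u)\cdot\nabla\varphi-|u|^{\alpha-1}u\,\partial_t\varphi\Big)\,dx\,dt=0\qquad\text{for all }\varphi\in C_c^\infty(\Omega_T). \] Here $f\in L^q(0,T;L^q_{\rm loc}(\Omega))$ means $f\in L^q(K\times(0,T))$ for every compact $K\subset\Omega$, and $|a|^{\alpha-1}a:=0$ for $a=0$. Then $|u|^{\alpha-1}u\in C([0,T];L^{\frac1\alpha+1}_{\rm loc}(\Omega))$: there is a map $v:[0,T]\to L^{\frac1\alpha+1}_{\rm loc}(\Omega)$ which, for every compact $K\subset\Omega$, is continuous from $[0,T]$ into $L^{\frac1\alpha+1}(K)$, and $v(t)(x)=|u(x,t)|^{\alpha-1}u(x,t)$ for a.e. $(x,t)\in\Omega_T$. -/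

import Mathlib

open MeasureTheory Set Filter Topology
open scoped ContDiff

noncomputable section

/-- Signed power: `a ^ γ = |a| ^ (γ - 1) * a`, equal to `0` at `a = 0`. -/
def signedPow (γ a : ℝ) : ℝ := |a| ^ (γ - 1) * a

/-- The space-time cylinder `Ω × (0, T)`. -/
def cylinder {N : ℕ} (Ω : Set (EuclideanSpace ℝ (Fin N))) (T : ℝ) :
    Set (EuclideanSpace ℝ (Fin N) × ℝ) := Ω ×ˢ Ioo 0 T

/-- `A : Ω × (0, T) × ℝ × ℝ^N → ℝ^N` is a Caratheodory vector field: measurable in `(x, t)` for all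
`(s, ξ)` and continuous in `(s, ξ)` for almost every `(x, t)`. -/
structure IsCaratheodory {N : ℕ} (Ω : Set (EuclideanSpace ℝ (Fin N))) (T : ℝ)
    (A : EuclideanSpace ℝ (Fin N) → ℝ → ℝ → EuclideanSpace ℝ (Fin N) →
      EuclideanSpace ℝ (Fin N)) : Prop where
  measurable : ∀ (s : ℝ) (ξ : EuclideanSpace ℝ (Fin N)),
    AEStronglyMeasurable (fun z : EuclideanSpace ℝ (Fin N) × ℝ => A z.1 z.2 s ξ)
      (volume.restrict (cylinder Ω T))
  continuous : ∀ᵐ z ∂(volume.restrict (cylinder Ω T)),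
    Continuous (fun w : ℝ × EuclideanSpace ℝ (Fin N) => A z.1 z.2 w.1 w.2)

/-- The anisotropic coercivity and growth conditions with constant `Λ` and exponents `p i`. -/
structure StructureConditions {N : ℕ} (Ω : Set (EuclideanSpace ℝ (Fin N))) (T Λ : ℝ)
    (p : Fin N → ℝ)
    (A : EuclideanSpace ℝ (Fin N) → ℝ → ℝ → EuclideanSpace ℝ (Fin N) →
      EuclideanSpace ℝ (Fin N)) : Prop where
  coercive : ∀ᵐ z ∂(volume.restrict (cylinder Ω T)), ∀ (s : ℝ) (ξ : EuclideanSpace ℝ (Fin N)),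
    Λ⁻¹ * ∑ i, |ξ i| ^ p i ≤ ∑ i, A z.1 z.2 s ξ i * ξ i
  growth : ∀ᵐ z ∂(volume.restrict (cylinder Ω T)), ∀ (s : ℝ) (ξ : EuclideanSpace ℝ (Fin N)),
    ∀ i, |A z.1 z.2 s ξ i| ≤ Λ * (∑ k, |ξ k| ^ p k) ^ ((p i - 1) / p i)

/-- `f` belongs to `W^{1,1}_loc(Ω)` with weak gradient `g`. -/
structure HasWeakGradient {N : ℕ} (Ω : Set (EuclideanSpace ℝ (Fin N)))
    (f : EuclideanSpace ℝ (Fin N) → ℝ)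
    (g : EuclideanSpace ℝ (Fin N) → EuclideanSpace ℝ (Fin N)) : Prop where
  integrable : ∀ K ⊆ Ω, IsCompact K → IntegrableOn f K
  integrable_grad : ∀ K ⊆ Ω, IsCompact K → IntegrableOn g K
  integral_eq : ∀ φ : EuclideanSpace ℝ (Fin N) → ℝ, ContDiff ℝ ∞ φ → HasCompactSupport φ →
    tsupport φ ⊆ Ω → ∀ i,
      ∫ x in Ω, f x * fderiv ℝ φ x (EuclideanSpace.single i 1) = - ∫ x in Ω, g x i * φ x

/-- `f ∈ L^q(0, T; L^q_loc(Ω))`: `f ∈ L^q(K × (0, T))` for every compact `K ⊆ Ω`. -/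
def MemLpLoc {N : ℕ} (Ω : Set (EuclideanSpace ℝ (Fin N))) (T q : ℝ)
    (f : EuclideanSpace ℝ (Fin N) × ℝ → ℝ) : Prop :=
  ∀ K ⊆ Ω, IsCompact K → MemLp f (ENNReal.ofReal q) (volume.restrict (cylinder K T))

/-- `u ∈ L^𝐩(0, T; W^{1,𝐩}_loc(Ω))` with spatial weak gradient `G`: that is,
`u ∈ L^1(0, T; W^{1,1}_loc(Ω))` and `∂_i u ∈ L^{p_i}(0, T; L^{p_i}_loc(Ω))` for every `i`. -/
structure MemAnisotropicSobolevLoc {N : ℕ} (Ω : Set (EuclideanSpace ℝ (Fin N))) (T : ℝ)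
    (p : Fin N → ℝ) (u : EuclideanSpace ℝ (Fin N) × ℝ → ℝ)
    (G : EuclideanSpace ℝ (Fin N) × ℝ → EuclideanSpace ℝ (Fin N)) : Prop where
  memLp_one : MemLpLoc Ω T 1 u
  memLp_one_grad : ∀ i, MemLpLoc Ω T 1 (fun z => G z i)
  weakGradient : ∀ᵐ t ∂(volume.restrict (Ioo 0 T)),
    HasWeakGradient Ω (fun x => u (x, t)) (fun x => G (x, t))
  memLp_grad : ∀ i, MemLpLoc Ω T (p i) (fun z => G z i)

/-- `u ∈ L^𝐩(0, T; W^{1,𝐩}_loc(Ω)) ∩ L^P(0, T; L^P_loc(Ω))`, `P = max {α + 1, p_1, …, p_N}`, is a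
weak solution of `∂_t (|u|^{α-1} u) - ∇ · A(x, t, u, ∇u) = 0` in `Ω × (0, T)`. -/
def IsWeakSolution {N : ℕ} (Ω : Set (EuclideanSpace ℝ (Fin N))) (T α : ℝ) (p : Fin N → ℝ)
    (A : EuclideanSpace ℝ (Fin N) → ℝ → ℝ → EuclideanSpace ℝ (Fin N) →
      EuclideanSpace ℝ (Fin N))
    (u : EuclideanSpace ℝ (Fin N) × ℝ → ℝ) : Prop :=
  ∃ G : EuclideanSpace ℝ (Fin N) × ℝ → EuclideanSpace ℝ (Fin N),
    MemAnisotropicSobolevLoc Ω T p u G ∧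
    MemLpLoc Ω T (max (α + 1) (⨆ i, p i)) u ∧
    ∀ φ : EuclideanSpace ℝ (Fin N) × ℝ → ℝ, ContDiff ℝ ∞ φ → HasCompactSupport φ →
      tsupport φ ⊆ cylinder Ω T →
      ∫ z in cylinder Ω T,
        ((∑ i, A z.1 z.2 (u z) (G z) i * fderiv ℝ φ z (EuclideanSpace.single i 1, 0))
          - signedPow α (u z) * fderiv ℝ φ z (0, 1)) = 0

/-- `f ∈ C([0, T]; L^q_loc(Ω))`, for a function `f` defined almost everywhere on `Ω × (0, T)`: some
`v : [0, T] → L^q_loc(Ω)`, continuous in `L^q(K)` for each compact `K ⊆ Ω`, equals `f` almost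
everywhere on `Ω × (0, T)`. -/
def MemContLpLoc {N : ℕ} (Ω : Set (EuclideanSpace ℝ (Fin N))) (T q : ℝ)
    (f : EuclideanSpace ℝ (Fin N) × ℝ → ℝ) : Prop :=
  ∃ v : ℝ → EuclideanSpace ℝ (Fin N) → ℝ,
    (∀ K ⊆ Ω, IsCompact K →
      (∀ t ∈ Icc 0 T, MemLp (v t) (ENNReal.ofReal q) (volume.restrict K)) ∧
      ∀ t₀ ∈ Icc 0 T,
        Tendsto (fun t => eLpNorm (v t - v t₀) (ENNReal.ofReal q) (volume.restrict K))
          (𝓝[Icc 0 T] t₀) (𝓝 0)) ∧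
    ∀ᵐ z ∂(volume.restrict (cylinder Ω T)), v z.2 z.1 = f z

end

/-!
The equation controls the time derivative of `w = |u| ^ (α - 1) u` only in a negative Sobolev
space, so continuity in `L ^ q`, `q = 1 / α + 1`, has to come from an energy argument. Here
`u = |w| ^ (q - 2) w` is the derivative of the convex function `Φ = |·| ^ q / q` at `w`, and `Φ` is
uniformly convex because `q ≥ 2`.

Fix a cutoff function `η`. For almost every pair of times `s < t` and for `r = s`, `r = t` or a
time in between, the equation between `s` and `t` can be tested with the function `η u(r)` of `x`
alone. By Young's inequality and the structure conditions this gives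
`|∫ η u(r) (w(t) - w(s))| ≤ ∫ₛᵗ m + (t - s) m(r)`, where `m(τ)` bounds the natural energy of
`u(τ)` and is integrable in time (`abs_setIntegral_mul_le_of_two_times`). No mollification in time
is needed. Testing with a Sobolev function is justified by mollification in `x`
(`setIntegral_mul_le_of_forall_test_function`). The exceptional null set of times does not depend
on the test function, since a countable family of test functions is dense
(`exists_ae_forall_two_times`).

Convexity turns the cases `r = s` and `r = t` into two-sided bounds for the increments of
`∫ η Φ(w(t))`. These bounds contain values of `m` at single times, which are not controlled; adding
them up along a fine grid, whose points are chosen such that `m` is at most its average, leaves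
only `5 ∫ₛᵗ m` (`abs_sub_le_of_chain`). Uniform convexity at a time `r` in `(s, t)` where `m` is at
most its average then yields `∫ η |w(t) - w(s)| ^ q ≤ c ∫ₛᵗ m` for almost all `s < t`
(`integral_abs_sub_rpow_le_of_energy`, `IsWeakSolution.exists_modulus`).

Hence `w` is uniformly continuous into `L ^ q(K)` on a set of times of full measure, for every
compact `K ⊆ Ω`. It extends to `[0, T]` by completeness, and the extensions over an exhaustion of
`Ω` by compact sets fit together (`memContLpLoc_of_modulus`).
-/

/-! ### Scalar inequalities for the power function -/

lemma abs_signedPow {γ : ℝ} (hγ : 0 < γ) (a : ℝ) : |signedPow γ a| = |a| ^ γ := by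
  rcases eq_or_ne a 0 with rfl | ha
  · simp [signedPow, Real.zero_rpow hγ.ne']
  · have h : 0 < |a| := abs_pos.2 ha
    rw [signedPow, abs_mul, abs_of_nonneg (Real.rpow_nonneg (abs_nonneg a) _), Real.rpow_sub_one h.ne',
      div_mul_cancel₀ _ h.ne']

lemma signedPow_mul_self {γ : ℝ} (hγ : 0 < γ) (a : ℝ) : signedPow γ a * a = |a| ^ (γ + 1) := by
  rcases eq_or_ne a 0 with rfl | ha
  · simp [signedPow, Real.zero_rpow (by linarith : γ + 1 ≠ 0)]
  · have h : 0 < |a| := abs_pos.2 ha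
    rw [signedPow, mul_assoc, ← abs_mul_abs_self a, ← mul_assoc, Real.rpow_sub_one h.ne',
      div_mul_cancel₀ _ h.ne', Real.rpow_add_one h.ne']

lemma signedPow_signedPow_inv {α : ℝ} (hα : 0 < α) (a : ℝ) :
    signedPow (1 / α) (signedPow α a) = a := by
  rcases eq_or_ne a 0 with rfl | ha
  · simp [signedPow]
  · have h : 0 < |a| := abs_pos.2 ha
    rw [signedPow, abs_signedPow hα, signedPow, ← mul_assoc, ← Real.rpow_mul h.le, ← Real.rpow_add h]
    have : α * (1 / α - 1) + (α - 1) = 0 := by field_simp; ring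
    rw [this, Real.rpow_zero, one_mul]

lemma measurable_signedPow (γ : ℝ) : Measurable (signedPow γ) := by
  unfold signedPow
  fun_prop

/-- The graph of `|·| ^ q / q` lies above its tangents. -/
lemma abs_rpow_tangent_le {q : ℝ} (hq : 1 < q) (a b : ℝ) :
    |b| ^ q / q + signedPow (q - 1) b * (a - b) ≤ |a| ^ q / q := by
  have h1 : signedPow (q - 1) b * a ≤ |a| * |b| ^ (q - 1) := by
    calc signedPow (q - 1) b * a ≤ |signedPow (q - 1) b * a| := le_abs_self _
      _ = _ := by rw [abs_mul, abs_signedPow (by linarith), mul_comm]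
  have hc := Real.HolderConjugate.conjExponent hq
  have h2 := Real.young_inequality_of_nonneg (abs_nonneg a)
    (Real.rpow_nonneg (abs_nonneg b) (q - 1)) hc
  have h3 : (|b| ^ (q - 1)) ^ (Real.conjExponent q) = |b| ^ q := by
    rw [← Real.rpow_mul (abs_nonneg b), Real.conjExponent]
    congr 1
    field_simp [sub_ne_zero.2 hq.ne']
  have h4 : signedPow (q - 1) b * b = |b| ^ q := by
    rw [signedPow_mul_self (by linarith)]; congr 1; ring
  rw [h3, Real.conjExponent, div_div_eq_mul_div] at h2
  have h5 : |b| ^ q * (q - 1) / q = |b| ^ q - |b| ^ q / q := by field_simp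
  rw [h5] at h2
  rw [mul_sub, h4]
  linarith

/-- Clarkson's inequality for real numbers. -/
lemma abs_midpoint_rpow_add_le {q : ℝ} (hq : 2 ≤ q) (a b : ℝ) :
    |(a + b) / 2| ^ q + |(a - b) / 2| ^ q ≤ (|a| ^ q + |b| ^ q) / 2 := by
  have key : ∀ x : ℝ, |x| ^ q = (x ^ 2) ^ (q / 2) := fun x => by
    rw [← sq_abs, ← Real.rpow_natCast, ← Real.rpow_mul (abs_nonneg x)]
    congr 1; push_cast; ring
  simp only [key]
  have hq2 : 1 ≤ q / 2 := by linarith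
  have h1 := Real.add_rpow_le_rpow_add (sq_nonneg ((a + b) / 2)) (sq_nonneg ((a - b) / 2)) hq2
  have h2 := (convexOn_rpow hq2).2 (sq_nonneg a : a ^ 2 ∈ Ici (0 : ℝ)) (sq_nonneg b : b ^ 2 ∈ Ici 0)
    (by norm_num : (0 : ℝ) ≤ 1 / 2) (by norm_num : (0 : ℝ) ≤ 1 / 2) (by norm_num)
  simp only [smul_eq_mul] at h2
  have h3 : ((a + b) / 2) ^ 2 + ((a - b) / 2) ^ 2 = 1 / 2 * a ^ 2 + 1 / 2 * b ^ 2 := by ring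
  rw [h3] at h1
  linarith

/-- Uniform convexity of `|·| ^ q / q` for `q ≥ 2`: the gap to a tangent controls the `q`-th power
of the distance. -/
lemma uniformConvex_abs_rpow {q : ℝ} (hq : 2 ≤ q) (a b : ℝ) :
    2 * |(a - b) / 2| ^ q ≤ |a| ^ q - |b| ^ q - q * (signedPow (q - 1) b * (a - b)) := by
  have h1 := abs_rpow_tangent_le (by linarith : 1 < q) ((a + b) / 2) b
  have h2 := abs_midpoint_rpow_add_le hq a b
  have hq0 : (0 : ℝ) < q := by linarith
  rw [div_add' _ _ _ hq0.ne', div_le_div_iff_of_pos_right hq0] at h1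
  nlinarith

/-- The parallelogram-type bound `|a - b| ^ q ≤ 2 ^ (q - 1) (|a - c| ^ q + |b - c| ^ q)`, with the
factors `1 / 2` put inside. -/
lemma abs_half_sub_rpow_le {q : ℝ} (hq : 1 ≤ q) (a b c : ℝ) :
    2 * |(a - b) / 2| ^ q ≤ |a - c| ^ q + |b - c| ^ q := by
  have h2 := (convexOn_rpow hq).2 (abs_nonneg (a - c) : |a - c| ∈ Ici (0 : ℝ))
    (abs_nonneg (b - c) : |b - c| ∈ Ici (0 : ℝ))
    (by norm_num : (0 : ℝ) ≤ 1 / 2) (by norm_num : (0 : ℝ) ≤ 1 / 2) (by norm_num)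
  simp only [smul_eq_mul] at h2
  have h3 : |(a - b) / 2| ≤ 1 / 2 * |a - c| + 1 / 2 * |b - c| := by
    rw [abs_div, abs_two]
    have : |a - b| ≤ |a - c| + |c - b| := abs_sub_le _ _ _
    rw [abs_sub_comm c b] at this
    linarith
  have h4 := Real.rpow_le_rpow (abs_nonneg _) h3 (by linarith : 0 ≤ q)
  linarith

/-! ### A chaining lemma on an interval -/

/-- Let `M` be the primitive of `m`. A bound on the increments of `E` which involves the values of
`m` at both end points improves to one by the increments of `M` alone: along a fine grid, the
intermediate points can be chosen where `m` is at most its average, and the two end points only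
contribute the mesh size times a constant. -/
lemma abs_sub_le_of_chain {S : Set ℝ} {E m M : ℝ → ℝ} {T : ℝ} (hST : S ⊆ Ioo 0 T)
    (hsel : ∀ c d, 0 ≤ c → c < d → d ≤ T → ∃ r ∈ S, c < r ∧ r < d ∧ (d - c) * m r ≤ M d - M c)
    (hm : ∀ t, 0 ≤ m t)
    (hE : ∀ s ∈ S, ∀ t ∈ S, s < t → |E t - E s| ≤ M t - M s + (t - s) * (m s + m t))
    {s t : ℝ} (hs : s ∈ S) (ht : t ∈ S) (hst : s < t) : |E t - E s| ≤ 5 * (M t - M s) := by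
  have hs0 := (hST hs).1
  have htT := (hST ht).2
  have main : ∀ n : ℕ, |E t - E s| ≤ 5 * (M t - M s) + (t - s) / (n + 1) * (m s + m t) := by
    intro n
    set δ : ℝ := (t - s) / (n + 1) with hδ
    have hδ0 : 0 < δ := div_pos (sub_pos.2 hst) (by positivity)
    have hδn : (n + 1) * δ = t - s := by rw [hδ]; field_simp
    have claim : ∀ k : ℕ, k ≤ n → ∃ r ∈ S, s + k * δ < r ∧ r < s + (k + 1) * δ ∧
        δ * m r ≤ M (s + (k + 1) * δ) - M (s + k * δ) ∧
        |E r - E s| ≤ M r - M s + 4 * (M (s + k * δ) - M s)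
          + 2 * (M (s + (k + 1) * δ) - M (s + k * δ)) + δ * m s := by
      intro k
      induction k with
      | zero =>
        intro _
        obtain ⟨r, hrS, h1, h2, h3⟩ := hsel s (s + δ) hs0.le (by linarith) (by nlinarith)
        refine ⟨r, hrS, by simpa using h1, by simpa using h2, by simpa using h3, ?_⟩
        have h4 := hE s hs r hrS h1
        have h5 : (r - s) * (m s + m r) ≤ δ * (m s + m r) :=
          mul_le_mul_of_nonneg_right (by linarith) (add_nonneg (hm _) (hm _))
        have h6 : 0 ≤ δ * m r := mul_nonneg hδ0.le (hm r)
        simp only [Nat.cast_zero, zero_mul, add_zero, zero_add, one_mul]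
        simp only [add_sub_cancel_left] at h3
        linarith
      | succ k ih =>
        intro hk
        obtain ⟨r, hrS, hr1, hr2, hr3, hr4⟩ := ih (by omega)
        have hkn : ((k : ℝ) + 1 + 1) ≤ n + 1 := by exact_mod_cast Nat.succ_le_succ hk
        have hub : s + ((k : ℝ) + 1 + 1) * δ ≤ t := by nlinarith
        obtain ⟨r', hrS', h1, h2, h3⟩ := hsel (s + (k + 1) * δ) (s + (k + 1 + 1) * δ)
          (by positivity) (by linarith) (by linarith)
        have e1 : s + ((k : ℝ) + 1 + 1) * δ - (s + (k + 1) * δ) = δ := by ring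
        rw [e1] at h3
        push_cast
        refine ⟨r', hrS', h1, h2, h3, ?_⟩
        have h4 := hE r hrS r' hrS' (by linarith)
        have h5 : (r' - r) * (m r + m r') ≤ (2 * δ) * (m r + m r') :=
          mul_le_mul_of_nonneg_right (by linarith) (add_nonneg (hm _) (hm _))
        have h6 := abs_sub_le (E r') (E r) (E s)
        linarith
    obtain ⟨r, hrS, hr1, hr2, hr3, hr4⟩ := claim n le_rfl
    rw [hδn] at hr2 hr3 hr4
    have e2 : s + (t - s) = t := by ring
    rw [e2] at hr2 hr3 hr4
    have h4 := hE r hrS t ht hr2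
    have h5 : (t - r) * (m r + m t) ≤ δ * (m r + m t) :=
      mul_le_mul_of_nonneg_right (by linarith) (add_nonneg (hm _) (hm _))
    have h6 := abs_sub_le (E t) (E r) (E s)
    have h7 : 0 ≤ δ * m r := mul_nonneg hδ0.le (hm r)
    linarith
  have hlim : Tendsto (fun n : ℕ => 5 * (M t - M s) + (t - s) / (n + 1) * (m s + m t)) atTop
      (𝓝 (5 * (M t - M s) + 0 * (m s + m t))) := by
    have : Tendsto (fun n : ℕ => (t - s) / ((n : ℝ) + 1)) atTop (𝓝 0) := by
      have h := (tendsto_one_div_add_atTop_nhds_zero_nat (𝕜 := ℝ)).const_mul (t - s)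
      simpa [div_eq_mul_inv] using h
    exact (this.mul_const _).const_add _
  simpa using ge_of_tendsto' hlim main

/-- In every interval there are points, outside any null set, where an integrable function is at
most its average. -/
lemma exists_mem_mul_le_integral {S : Set ℝ} {m : ℝ → ℝ} {T : ℝ}
    (hS : ∀ᵐ t ∂(volume.restrict (Ioo 0 T)), t ∈ S) (hm : IntegrableOn m (Ioo 0 T))
    {c d : ℝ} (hc : 0 ≤ c) (hcd : c < d) (hd : d ≤ T) :
    ∃ r ∈ S, c < r ∧ r < d ∧ (d - c) * m r ≤ ∫ τ in c..d, m τ := by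
  have hsub : Ioo c d ⊆ Ioo 0 T := Ioo_subset_Ioo hc hd
  have hS' : ∀ᵐ t ∂(volume.restrict (Ioo c d)), t ∈ S ∩ Ioo c d := by
    filter_upwards [ae_restrict_of_ae_restrict_of_subset hsub hS,
      ae_restrict_mem measurableSet_Ioo] with t h1 h2 using ⟨h1, h2⟩
  have hne : volume.restrict (Ioo c d) ≠ 0 := by
    simp [Measure.restrict_eq_zero, hcd]
  obtain ⟨r, hr, hle⟩ := exists_notMem_null_le_average hne (hm.mono_set hsub) hS'
  have hr' : r ∈ S ∩ Ioo c d := not_not.1 hr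
  refine ⟨r, hr'.1, hr'.2.1, hr'.2.2, ?_⟩
  rw [setAverage_eq, Measure.real, Real.volume_Ioo, ENNReal.toReal_ofReal (by linarith),
    smul_eq_mul] at hle
  have h0 : 0 < d - c := by linarith
  rw [intervalIntegral.integral_of_le hcd.le, integral_Ioc_eq_integral_Ioo]
  calc (d - c) * m r ≤ (d - c) * ((d - c)⁻¹ * ∫ x in Ioo c d, m x) := by gcongr
    _ = _ := by field_simp

/-! ### Weak derivatives on an interval -/

lemma setIntegral_eq_integral_of_tsupport_subset {F : Type*} [NormedAddCommGroup F] [NormedSpace ℝ F]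
    {X : Type*} [MeasurableSpace X] [TopologicalSpace X] {μ : Measure X}
    {f : X → F} {s : Set X} (h : tsupport f ⊆ s) : ∫ x in s, f x ∂μ = ∫ x, f x ∂μ :=
  setIntegral_eq_integral_of_forall_compl_eq_zero fun _ hx =>
    image_eq_zero_of_notMem_tsupport fun h' => hx (h h')

/-- A compactly supported smooth function on an interval with zero mean is the derivative of a
compactly supported smooth function on that interval. -/
lemma exists_compactly_supported_primitive {T : ℝ} (hT : 0 < T) {g : ℝ → ℝ}
    (hg : ContDiff ℝ ∞ g) (hgc : HasCompactSupport g) (hgs : tsupport g ⊆ Ioo 0 T)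
    (hg0 : ∫ t, g t = 0) :
    ∃ θ : ℝ → ℝ, ContDiff ℝ ∞ θ ∧ HasCompactSupport θ ∧ tsupport θ ⊆ Ioo 0 T ∧ deriv θ = g := by
  -- the support stays away from both end points
  obtain ⟨a, ha0, haT, ha⟩ : ∃ a, 0 < a ∧ a < T ∧ ∀ t ∈ tsupport g, a ≤ t := by
    rcases (tsupport g).eq_empty_or_nonempty with h | h
    · exact ⟨T / 2, by linarith, by linarith, by simp [h]⟩
    · obtain ⟨a, h1, h2⟩ := IsCompact.exists_isLeast hgc h
      exact ⟨a, (hgs h1).1, (hgs h1).2, h2⟩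
  obtain ⟨b, hab, hbT, hb⟩ : ∃ b, a ≤ b ∧ b < T ∧ ∀ t ∈ tsupport g, t ≤ b := by
    rcases (tsupport g).eq_empty_or_nonempty with h | h
    · exact ⟨a, le_rfl, haT, by simp [h]⟩
    · obtain ⟨b, h1, h2⟩ := IsCompact.exists_isGreatest hgc h
      exact ⟨b, ha b h1, (hgs h1).2, h2⟩
  have hzl : ∀ t, t < a → g t = 0 := fun t ht =>
    image_eq_zero_of_notMem_tsupport fun h => absurd (ha t h) (not_le.2 ht)
  have hzr : ∀ t, b < t → g t = 0 := fun t ht =>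
    image_eq_zero_of_notMem_tsupport fun h => absurd (hb t h) (not_le.2 ht)
  have hd : ∀ t, HasDerivAt (fun t => ∫ τ in (0 : ℝ)..t, g τ) (g t) t := fun t =>
    hg.continuous.integral_hasStrictDerivAt 0 t |>.hasDerivAt
  have hderiv : deriv (fun t => ∫ τ in (0 : ℝ)..t, g τ) = g := funext fun t => (hd t).deriv
  have hsupp : Function.support (fun t => ∫ τ in (0 : ℝ)..t, g τ) ⊆ Icc a b := by
    intro t ht
    by_contra hcon
    apply ht
    change ∫ τ in (0 : ℝ)..t, g τ = 0
    rw [mem_Icc, not_and_or, not_le, not_le] at hcon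
    rcases hcon with h | h
    · rw [intervalIntegral.integral_congr (g := fun _ => (0 : ℝ)) fun τ hτ => hzl τ ?_]
      · simp
      · exact lt_of_le_of_lt hτ.2 (max_lt ha0 h)
    · rw [intervalIntegral.integral_of_le (by linarith), ← hg0]
      refine setIntegral_eq_integral_of_forall_compl_eq_zero fun τ hτ => ?_
      rw [mem_Ioc, not_and_or, not_lt, not_le] at hτ
      rcases hτ with h' | h'
      · exact hzl τ (by linarith)
      · exact hzr τ (by linarith)
  have hts : tsupport (fun t => ∫ τ in (0 : ℝ)..t, g τ) ⊆ Icc a b :=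
    closure_minimal hsupp isClosed_Icc
  refine ⟨_, ?_, HasCompactSupport.of_support_subset_isCompact isCompact_Icc hsupp,
    fun t ht => ⟨ha0.trans_le (hts ht).1, (hts ht).2.trans_lt hbT⟩, hderiv⟩
  rw [contDiff_infty_iff_deriv]
  exact ⟨fun t => (hd t).differentiableAt, by rwa [hderiv]⟩

/-- An integrable function on an interval with vanishing weak derivative is constant. -/
lemma exists_ae_eq_const_of_integral_deriv_mul_eq_zero {T : ℝ} (hT : 0 < T) {B : ℝ → ℝ}
    (hB : IntegrableOn B (Ioo 0 T))
    (h : ∀ θ : ℝ → ℝ, ContDiff ℝ ∞ θ → HasCompactSupport θ → tsupport θ ⊆ Ioo 0 T →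
      ∫ t in Ioo 0 T, deriv θ t * B t = 0) :
    ∃ c, ∀ᵐ t ∂(volume.restrict (Ioo 0 T)), B t = c := by
  -- a bump function of unit mass inside the interval
  let f : ContDiffBump (T / 2) := ⟨T / 8, T / 4, by linarith, by linarith⟩
  let ρ : ℝ → ℝ := f.normed volume
  have hρs : tsupport ρ ⊆ Ioo 0 T := by
    intro t ht
    rw [f.tsupport_normed_eq, Real.closedBall_eq_Icc] at ht
    exact ⟨lt_of_lt_of_le (by change 0 < T / 2 - T / 4; linarith) ht.1,
      lt_of_le_of_lt ht.2 (by change T / 2 + T / 4 < T; linarith)⟩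
  have hρc : HasCompactSupport ρ := f.hasCompactSupport_normed
  have hρ : ContDiff ℝ ∞ ρ := f.contDiff_normed
  set c : ℝ := ∫ t in Ioo 0 T, ρ t * B t with hc
  refine ⟨c, ?_⟩
  have hint : ∀ ζ : ℝ → ℝ, Continuous ζ → HasCompactSupport ζ →
      IntegrableOn (fun t => ζ t * B t) (Ioo 0 T) := fun ζ h1 h2 => by
    obtain ⟨C, hC⟩ := h1.bounded_above_of_compact_support h2
    exact hB.bdd_mul (c := C) h1.aestronglyMeasurable (ae_of_all _ hC)
  have key : ∀ᵐ t, t ∈ Ioo 0 T → B t - c = 0 := by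
    refine isOpen_Ioo.ae_eq_zero_of_integral_contDiff_smul_eq_zero
      (IntegrableOn.locallyIntegrableOn (hB.sub (integrableOn_const (by simp)))) ?_
    intro ζ hζ hζc hζs
    have hζi := hζ.continuous.integrable_of_hasCompactSupport (μ := volume) hζc
    have hρi := hρ.continuous.integrable_of_hasCompactSupport (μ := volume) hρc
    have hmulc : HasCompactSupport (fun t => (∫ τ, ζ τ) * ρ t) := hρc.mul_left
    have hts : tsupport (fun t => (∫ τ, ζ τ) * ρ t) ⊆ Ioo 0 T :=
      (closure_mono fun t ht => right_ne_zero_of_mul ht).trans hρs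
    obtain ⟨θ, h1, h2, h3, h4⟩ := exists_compactly_supported_primitive hT
      (g := fun t => ζ t - (∫ τ, ζ τ) * ρ t) (hζ.sub (contDiff_const.mul hρ)) (hζc.sub hmulc)
      ((tsupport_sub _ _).trans (union_subset hζs hts)) (by
        rw [integral_sub hζi (hρi.const_mul _), integral_const_mul, f.integral_normed]; ring)
    have h5 := h θ h1 h2 h3
    rw [h4] at h5
    have h6 : ∫ t, ζ t • (B t - c) = ∫ t in Ioo 0 T, (ζ t * B t - c * ζ t) := by
      rw [← setIntegral_eq_integral_of_forall_compl_eq_zero (s := Ioo 0 T)]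
      · simp only [smul_eq_mul]; congr 1; ext t; ring
      · intro t ht
        rw [image_eq_zero_of_notMem_tsupport fun h' => ht (hζs h'), zero_smul]
    rw [h6, integral_sub (hint ζ hζ.continuous hζc) (hζi.integrableOn.const_mul c),
      integral_const_mul, setIntegral_eq_integral_of_tsupport_subset hζs, hc]
    have h7 : (fun t => (ζ t - (∫ τ, ζ τ) * ρ t) * B t)
        = fun t => ζ t * B t - (∫ τ, ζ τ) * (ρ t * B t) := by ext t; ring
    rw [h7, integral_sub (hint ζ hζ.continuous hζc)
      ((hint ρ hρ.continuous hρc).const_mul _), integral_const_mul] at h5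
    linarith
  rw [ae_restrict_iff' measurableSet_Ioo]
  filter_upwards [key] with t ht h' using sub_eq_zero.1 (ht h')

/-- If `-a` is the weak derivative of `b` on an interval, then `b` agrees almost everywhere with a
primitive of `-a`. -/
lemma exists_ae_eq_sub_integral_of_weak_deriv {T : ℝ} (hT : 0 < T) {a b : ℝ → ℝ}
    (ha : IntegrableOn a (Ioo 0 T)) (hb : IntegrableOn b (Ioo 0 T))
    (h : ∀ θ : ℝ → ℝ, ContDiff ℝ ∞ θ → HasCompactSupport θ → tsupport θ ⊆ Ioo 0 T →
      ∫ t in Ioo 0 T, θ t * a t = ∫ t in Ioo 0 T, deriv θ t * b t) :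
    ∃ c, ∀ᵐ t ∂(volume.restrict (Ioo 0 T)), b t = c - ∫ τ in (0 : ℝ)..t, a τ := by
  have haI : IntervalIntegrable a volume 0 T := by
    rwa [intervalIntegrable_iff_integrableOn_Ioo_of_le hT.le]
  have hAC := haI.absolutelyContinuousOnInterval_intervalIntegral (c := 0) (by simp)
  have hAint : IntegrableOn (fun t => ∫ τ in (0 : ℝ)..t, a τ) (Ioo 0 T) :=
    ((hAC.continuousOn.mono (by rw [uIcc_of_le hT.le])).integrableOn_Icc).mono_set Ioo_subset_Icc_self
  obtain ⟨c, hc⟩ := exists_ae_eq_const_of_integral_deriv_mul_eq_zero hT (hb.add hAint) (by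
    intro θ h1 h2 h3
    have hθAC : AbsolutelyContinuousOnInterval θ 0 T :=
      (h1.of_le (by norm_cast)).contDiffOn.absolutelyContinuousOnInterval
    have hparts := hθAC.integral_mul_deriv_eq_deriv_mul hAC
    have h0 : θ 0 = 0 := image_eq_zero_of_notMem_tsupport fun h' => absurd (h3 h').1 (lt_irrefl _)
    have hT0 : θ T = 0 := image_eq_zero_of_notMem_tsupport fun h' => absurd (h3 h').2 (lt_irrefl _)
    have hcongr : ∫ x in (0 : ℝ)..T, θ x * deriv (fun t => ∫ τ in (0 : ℝ)..t, a τ) x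
        = ∫ x in (0 : ℝ)..T, θ x * a x := by
      refine intervalIntegral.integral_congr_ae ?_
      filter_upwards [haI.ae_hasDerivAt_integral] with x hx hx'
      rw [(hx (uIoc_subset_uIcc hx') 0 (by simp)).deriv]
    rw [hcongr, h0, hT0] at hparts
    simp only [intervalIntegral.integral_of_le hT.le, integral_Ioc_eq_integral_Ioo] at hparts
    have hbdd : ∀ f : ℝ → ℝ, IntegrableOn f (Ioo 0 T) →
        IntegrableOn (fun t => deriv θ t * f t) (Ioo 0 T) := fun f hf => by
      have hcd : Continuous (deriv θ) := h1.continuous_deriv (by norm_cast)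
      obtain ⟨C, hC⟩ := hcd.bounded_above_of_compact_support h2.deriv
      exact hf.bdd_mul (c := C) hcd.aestronglyMeasurable (ae_of_all _ hC)
    simp only [Pi.add_apply, mul_add]
    have hθ := h θ h1 h2 h3
    rw [integral_add (hbdd _ hb) (hbdd _ hAint)]
    linarith)
  refine ⟨c, ?_⟩
  filter_upwards [hc] with t ht
  simp only [Pi.add_apply] at ht
  linarith

/-! ### A countable family of test functions -/

/-- Smooth functions supported in a compact set admit a countable subfamily which is dense for
uniform convergence of the functions and their derivatives. -/
lemma exists_seq_dense_test_functions {X : Type*} [NormedAddCommGroup X] [NormedSpace ℝ X]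
    [FiniteDimensional ℝ X] {K : Set X} (hK : IsCompact K) :
    ∃ ψ : ℕ → X → ℝ, (∀ n, ContDiff ℝ ∞ (ψ n) ∧ tsupport (ψ n) ⊆ K) ∧
      ∀ φ : X → ℝ, ContDiff ℝ ∞ φ → tsupport φ ⊆ K → ∀ ε > 0, ∃ n, ∀ x,
        |ψ n x - φ x| ≤ ε ∧ ‖fderiv ℝ (ψ n) x - fderiv ℝ φ x‖ ≤ ε := by
  have : CompactSpace K := isCompact_iff_compactSpace.1 hK
  let Y := {φ : X → ℝ // ContDiff ℝ ∞ φ ∧ tsupport φ ⊆ K}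
  -- the 1-jet, restricted to `K`, takes values in a separable metric space
  let j : Y → C(K, ℝ × (X →L[ℝ] ℝ)) := fun φ =>
    ⟨fun x => (φ.1 x, fderiv ℝ φ.1 x), by
      have h1 := φ.2.1.continuous
      have h2 := φ.2.1.continuous_fderiv (by norm_cast)
      fun_prop⟩
  have : Nonempty (range j) :=
    ⟨⟨j ⟨0, contDiff_const, by simp⟩, mem_range_self _⟩⟩
  let d := TopologicalSpace.denseSeq (range j)
  have hd : ∀ n, ∃ φ : Y, j φ = (d n : C(K, ℝ × (X →L[ℝ] ℝ))) := fun n => (d n).2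
  choose ψ hψ using hd
  refine ⟨fun n => (ψ n).1, fun n => (ψ n).2, fun φ hφ hφK ε hε => ?_⟩
  obtain ⟨n, hn⟩ := (TopologicalSpace.denseRange_denseSeq (range j)).exists_dist_lt
    (⟨j ⟨φ, hφ, hφK⟩, mem_range_self _⟩ : range j) hε
  refine ⟨n, fun x => ?_⟩
  by_cases hx : x ∈ K
  · have h1 : dist (j ⟨φ, hφ, hφK⟩ ⟨x, hx⟩) (j (ψ n) ⟨x, hx⟩) ≤ ε := by
      rw [hψ n]
      exact (ContinuousMap.dist_apply_le_dist _).trans hn.le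
    rw [dist_comm, Prod.dist_eq, max_le_iff, dist_eq_norm, dist_eq_norm] at h1
    exact h1
  · have hz : ∀ f : X → ℝ, tsupport f ⊆ K → f x = 0 ∧ fderiv ℝ f x = 0 := fun f hf =>
      ⟨image_eq_zero_of_notMem_tsupport fun h => hx (hf h),
        image_eq_zero_of_notMem_tsupport fun h => hx (hf (tsupport_fderiv_subset ℝ h))⟩
    simp only []
    rw [(hz _ (ψ n).2.2).1, (hz _ (ψ n).2.2).2, (hz φ hφK).1, (hz φ hφK).2]
    simp [hε.le]

/-! ### Mollification -/

open scoped Convolution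

section Mollification

variable {X : Type*} [NormedAddCommGroup X] [InnerProductSpace ℝ X] [FiniteDimensional ℝ X]
  [MeasurableSpace X] [BorelSpace X]

/-- Mollification does not increase the integral of a power: integrate, against the mollifier, the
tangent inequality at the value of the convolution. -/
lemma integral_abs_convolution_rpow_le (ρ : ContDiffBump (0 : X)) {p : ℝ} (hp : 1 < p) {f : X → ℝ}
    (hf : Integrable f) (hfp : Integrable (fun x => |f x| ^ p)) :
    Integrable (fun x => |(ρ.normed volume ⋆[ContinuousLinearMap.lsmul ℝ ℝ, volume] f) x| ^ p) ∧
      ∫ x, |(ρ.normed volume ⋆[ContinuousLinearMap.lsmul ℝ ℝ, volume] f) x| ^ p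
        ≤ ∫ x, |f x| ^ p := by
  set c : X → ℝ := ρ.normed volume ⋆[ContinuousLinearMap.lsmul ℝ ℝ, volume] f with hc
  set F : X → ℝ := fun x => |f x| ^ p with hF
  have hρi : Integrable (ρ.normed volume) volume := ρ.integrable_normed
  have hρc : Continuous (ρ.normed volume) := ρ.continuous_normed
  have hex : ∀ g : X → ℝ, Integrable g → ConvolutionExists (ρ.normed volume) g
      (ContinuousLinearMap.lsmul ℝ ℝ) volume := fun g hg =>
    HasCompactSupport.convolutionExists_left _ ρ.hasCompactSupport_normed hρc
      hg.locallyIntegrable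
  have hcc : Continuous c :=
    HasCompactSupport.continuous_convolution_left _ ρ.hasCompactSupport_normed hρc
      hf.locallyIntegrable
  have hpt : ∀ x, |c x| ^ p ≤
      (ρ.normed volume ⋆[ContinuousLinearMap.lsmul ℝ ℝ, volume] F) x := by
    intro x
    have h1 : Integrable (fun t => ρ.normed volume t * f (x - t)) := hex f hf x
    have h2 : Integrable (fun t => ρ.normed volume t * F (x - t)) := hex F hfp x
    have hp0 : (0 : ℝ) < p := by linarith
    have h1' : Integrable (fun t => ρ.normed volume t * f (x - t) - c x * ρ.normed volume t) :=
      h1.sub (hρi.const_mul _)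
    have h3 : ∫ t, (|c x| ^ p * ρ.normed volume t + p * signedPow (p - 1) (c x)
          * (ρ.normed volume t * f (x - t) - c x * ρ.normed volume t))
        ≤ ∫ t, ρ.normed volume t * F (x - t) := by
      refine integral_mono ((hρi.const_mul _).add (h1'.const_mul _)) h2
        fun t => ?_
      have h4 := abs_rpow_tangent_le hp (f (x - t)) (c x)
      rw [div_add' _ _ _ hp0.ne', div_le_div_iff_of_pos_right hp0] at h4
      have h5 := mul_le_mul_of_nonneg_left h4 (ρ.nonneg_normed (μ := volume) t)
      simp only [hF]
      linarith
    rw [integral_add (hρi.const_mul _) (h1'.const_mul _),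
      integral_const_mul, integral_const_mul, integral_sub h1 (hρi.const_mul _),
      integral_const_mul, ρ.integral_normed] at h3
    have h6 : ∫ t, ρ.normed volume t * f (x - t) = c x := rfl
    rw [h6] at h3
    have h7 : (ρ.normed volume ⋆[ContinuousLinearMap.lsmul ℝ ℝ, volume] F) x
      = ∫ t, ρ.normed volume t * F (x - t) := rfl
    rw [h7]
    linarith
  have hci : Integrable (ρ.normed volume ⋆[ContinuousLinearMap.lsmul ℝ ℝ, volume] F) volume :=
    hρi.integrable_convolution _ hfp
  have hint : Integrable (fun x => |c x| ^ p) := by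
    refine hci.mono' ?_ (ae_of_all _ fun x => ?_)
    · exact (hcc.abs.rpow_const fun _ => Or.inr (by linarith)).aestronglyMeasurable
    · rw [Real.norm_of_nonneg (Real.rpow_nonneg (abs_nonneg _) _)]
      exact hpt x
  refine ⟨hint, (integral_mono hint hci hpt).trans ?_⟩
  rw [integral_convolution (L := ContinuousLinearMap.lsmul ℝ ℝ) hρi hfp, ρ.integral_normed]
  simp

/-- Mollification commutes with a weak directional derivative. -/
lemma fderiv_convolution_of_weak_deriv (ρ : ContDiffBump (0 : X)) {v U : X → ℝ} (e : X)
    (hv : Integrable v)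
    (h : ∀ φ : X → ℝ, ContDiff ℝ ∞ φ → HasCompactSupport φ →
      ∫ x, v x * fderiv ℝ φ x e = - ∫ x, U x * φ x) (x : X) :
    fderiv ℝ (ρ.normed volume ⋆[ContinuousLinearMap.lsmul ℝ ℝ, volume] v) x e
      = (ρ.normed volume ⋆[ContinuousLinearMap.lsmul ℝ ℝ, volume] U) x := by
  have hρ : ContDiff ℝ ∞ (ρ.normed volume) := ρ.contDiff_normed
  have hρ1 : ContDiff ℝ 1 (ρ.normed volume) := ρ.contDiff_normed
  have h1 := HasCompactSupport.hasFDerivAt_convolution_left (ContinuousLinearMap.lsmul ℝ ℝ)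
    ρ.hasCompactSupport_normed hρ1 (hv.locallyIntegrable (μ := volume)) x
  rw [h1.fderiv]
  have hφd : ∀ y, HasFDerivAt (fun y => ρ.normed volume (x - y))
      (-(fderiv ℝ (ρ.normed volume) (x - y))) y := fun y => by
    have h2 : HasFDerivAt (fun y : X => x - y) (-(ContinuousLinearMap.id ℝ X)) y :=
      (hasFDerivAt_id y).const_sub x
    have h3 := ((hρ1.differentiable (by norm_num)) (x - y)).hasFDerivAt.comp y h2
    rwa [ContinuousLinearMap.comp_neg, ContinuousLinearMap.comp_id] at h3
  have h2 := h (fun y => ρ.normed volume (x - y)) (hρ.comp (contDiff_const.sub contDiff_id))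
    (ρ.hasCompactSupport_normed.comp_homeomorph (Homeomorph.subLeft x))
  have hconv : (ρ.normed volume ⋆[ContinuousLinearMap.lsmul ℝ ℝ, volume] U) x
      = ∫ y, ρ.normed volume (x - y) * U y := by
    rw [convolution_eq_swap]; rfl
  have hex : ConvolutionExistsAt (fderiv ℝ (ρ.normed volume)) v x
      ((ContinuousLinearMap.lsmul ℝ ℝ).precompL X) volume :=
    HasCompactSupport.convolutionExists_left _ (ρ.hasCompactSupport_normed.fderiv ℝ)
      (hρ1.continuous_fderiv (by norm_num)) hv.locallyIntegrable x
  rw [convolution_eq_swap, ContinuousLinearMap.integral_apply hex.integrable_swap, hconv]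
  simp only [(hφd _).fderiv] at h2
  have h4 : ∫ y, U y * ρ.normed volume (x - y) = ∫ y, ρ.normed volume (x - y) * U y := by
    simp only [mul_comm]
  rw [← h4, ← neg_eq_iff_eq_neg.2 h2, ← integral_neg]
  congr 1
  ext y
  simp [ContinuousLinearMap.precompL_apply, mul_comm]

/-- A form of Fatou's lemma for Bochner integrals. -/
lemma integral_le_of_tendsto_ae {Y : Type*} [MeasurableSpace Y] {μ : Measure Y} {f : ℕ → Y → ℝ}
    {g : Y → ℝ} {C : ℝ} (hf : ∀ n, Integrable (f n) μ) (hf0 : ∀ n x, 0 ≤ f n x)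
    (hg : Integrable g μ) (hlim : ∀ᵐ x ∂μ, Tendsto (fun n => f n x) atTop (𝓝 (g x)))
    (hC : ∀ n, ∫ x, f n x ∂μ ≤ C) : ∫ x, g x ∂μ ≤ C := by
  have hC0 : 0 ≤ C := (integral_nonneg (hf0 0)).trans (hC 0)
  have hg0 : 0 ≤ᵐ[μ] g := by
    filter_upwards [hlim] with x hx using ge_of_tendsto' hx fun n => hf0 n x
  rw [integral_eq_lintegral_of_nonneg_ae hg0 hg.aestronglyMeasurable]
  refine ENNReal.toReal_le_of_le_ofReal hC0 ?_
  calc ∫⁻ x, ENNReal.ofReal (g x) ∂μ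
      = ∫⁻ x, liminf (fun n => ENNReal.ofReal (f n x)) atTop ∂μ := by
        refine lintegral_congr_ae ?_
        filter_upwards [hlim] with x hx
        exact ((ENNReal.continuous_ofReal.tendsto _).comp hx).liminf_eq.symm
    _ ≤ liminf (fun n => ∫⁻ x, ENNReal.ofReal (f n x) ∂μ) atTop :=
        lintegral_liminf_le' fun n => (hf n).aemeasurable.ennreal_ofReal
    _ ≤ ENNReal.ofReal C := by
        refine liminf_le_of_frequently_le' (Frequently.of_forall fun n => ?_)
        rw [← ofReal_integral_eq_lintegral_ofReal (hf n) (ae_of_all _ (hf0 n))]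
        exact ENNReal.ofReal_le_ofReal (hC n)

lemma abs_mul_le_rpow_add_rpow {r q : ℝ} (h : r.HolderConjugate q) (a b : ℝ) :
    |a * b| ≤ |a| ^ r + |b| ^ q := by
  have h1 := Real.young_inequality_of_nonneg (abs_nonneg a) (abs_nonneg b) h
  rw [abs_mul]
  have h2 : |a| ^ r / r ≤ |a| ^ r :=
    div_le_self (Real.rpow_nonneg (abs_nonneg _) _) h.lt.le
  have h3 : |b| ^ q / q ≤ |b| ^ q :=
    div_le_self (Real.rpow_nonneg (abs_nonneg _) _) h.symm.lt.le
  linarith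

/-- A bound for `∫ ψ W` by the anisotropic energy of the test function `ψ` extends from smooth
functions to Sobolev functions `v` with compact support: the mollifications of `v` have no larger
energy, and Fatou's lemma passes to the limit in the left-hand side. -/
lemma setIntegral_mul_le_of_forall_test_function {ι : Type*} [Fintype ι] {e : ι → X} {p : ι → ℝ}
    (hp : ∀ i, 1 < p i)
    {K₀ K : Set X} {δ : ℝ} (hδ : 0 < δ) (hK₀ : IsCompact K₀) (hK : Metric.cthickening δ K₀ ⊆ K)
    {r q : ℝ} (hrq : r.HolderConjugate q)
    {v : X → ℝ} {U : ι → X → ℝ} (hvs : Function.support v ⊆ K₀) (hv : Integrable v)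
    (hvr : Integrable (fun x => |v x| ^ r)) (hU : ∀ i, Integrable (U i))
    (hUp : ∀ i, Integrable (fun x => |U i x| ^ p i))
    (hweak : ∀ i, ∀ φ : X → ℝ, ContDiff ℝ ∞ φ → HasCompactSupport φ →
      ∫ x, v x * fderiv ℝ φ x (e i) = - ∫ x, U i x * φ x)
    {W : X → ℝ} (hWm : AEStronglyMeasurable W (volume.restrict K))
    (hWq : IntegrableOn (fun x => |W x| ^ q) K) {B L : ℝ} (hL : 0 ≤ L)
    (hB : ∀ ψ : X → ℝ, ContDiff ℝ ∞ ψ → HasCompactSupport ψ → tsupport ψ ⊆ K →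
      (∀ i, Integrable (fun x => |fderiv ℝ ψ x (e i)| ^ p i)) →
      ∫ x in K, ψ x * W x ≤ B + L * ∑ i, ∫ x, |fderiv ℝ ψ x (e i)| ^ p i) :
    ∫ x in K, v x * W x ≤ B + L * ∑ i, ∫ x, |U i x| ^ p i := by
  let ρ : ℕ → ContDiffBump (0 : X) := fun n =>
    ⟨δ / 2 / (n + 1), δ / (n + 1), by positivity, by gcongr; linarith⟩
  let ψ : ℕ → X → ℝ := fun n =>
    (ρ n).normed volume ⋆[ContinuousLinearMap.lsmul ℝ ℝ, volume] v
  have hρlim : Tendsto (fun n => (ρ n).rOut) atTop (𝓝 0) := by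
    have h := (tendsto_one_div_add_atTop_nhds_zero_nat (𝕜 := ℝ)).const_mul δ
    simpa [ρ, div_eq_mul_inv] using h
  have hψlim : ∀ᵐ x, Tendsto (fun n => ψ n x) atTop (𝓝 (v x)) :=
    ContDiffBump.ae_convolution_tendsto_right_of_locallyIntegrable (K := 2) hρlim
      (Eventually.of_forall fun n => by
        change δ / (n + 1) ≤ 2 * (δ / 2 / (n + 1))
        apply le_of_eq; ring) hv.locallyIntegrable
  have hψK : ∀ n, tsupport (ψ n) ⊆ Metric.cthickening δ K₀ := by
    intro n
    refine closure_minimal ?_ Metric.isClosed_cthickening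
    refine (support_convolution_subset _).trans ?_
    rw [ContDiffBump.support_normed_eq]
    rintro _ ⟨y, hy, z, hz, rfl⟩
    refine Metric.mem_cthickening_of_dist_le _ z _ _ (hvs hz) ?_
    rw [dist_eq_norm, add_sub_cancel_right]
    have h1 : ‖y‖ < δ / (n + 1) := by simpa using hy
    have h2 : δ / (n + 1) ≤ δ := div_le_self hδ.le (by linarith [n.cast_nonneg (α := ℝ)])
    linarith
  have hψc : ∀ n, HasCompactSupport (ψ n) := fun n =>
    (hK₀.cthickening).of_isClosed_subset (isClosed_tsupport _) (hψK n)
  have hψs : ∀ n, ContDiff ℝ ∞ (ψ n) := fun n =>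
    HasCompactSupport.contDiff_convolution_left _ (ρ n).hasCompactSupport_normed
      (ρ n).contDiff_normed hv.locallyIntegrable
  have hψr : ∀ n, Integrable (fun x => |ψ n x| ^ r) ∧ ∫ x, |ψ n x| ^ r ≤ ∫ x, |v x| ^ r :=
    fun n => integral_abs_convolution_rpow_le (ρ n) hrq.lt hv hvr
  have hψd : ∀ n i x, fderiv ℝ (ψ n) x (e i)
      = ((ρ n).normed volume ⋆[ContinuousLinearMap.lsmul ℝ ℝ, volume] (U i)) x :=
    fun n i x => fderiv_convolution_of_weak_deriv (ρ n) (e i) hv (hweak i) x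
  have hψB : ∀ n, ∫ x in K, ψ n x * W x ≤ B + L * ∑ i, ∫ x, |U i x| ^ p i := by
    intro n
    have hi : ∀ i, Integrable (fun x => |fderiv ℝ (ψ n) x (e i)| ^ p i) ∧
        ∫ x, |fderiv ℝ (ψ n) x (e i)| ^ p i ≤ ∫ x, |U i x| ^ p i := fun i => by
      simp only [hψd]
      exact integral_abs_convolution_rpow_le (ρ n) (hp i) (hU i) (hUp i)
    refine (hB (ψ n) (hψs n) (hψc n) ((hψK n).trans hK) fun i => (hi i).1).trans ?_
    exact add_le_add_right (mul_le_mul_of_nonneg_left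
      (Finset.sum_le_sum fun i _ => (hi i).2) hL) B
  have hmulint : ∀ f : X → ℝ, AEStronglyMeasurable f (volume.restrict K) →
      IntegrableOn (fun x => |f x| ^ r) K → IntegrableOn (fun x => f x * W x) K :=
    fun f hf hfr => (hfr.add hWq).mono' (hf.mul hWm)
      (ae_of_all _ fun x => abs_mul_le_rpow_add_rpow hrq (f x) (W x))
  have hψint : ∀ n, IntegrableOn (fun x => ψ n x * W x) K := fun n =>
    hmulint _ (hψs n).continuous.aestronglyMeasurable (hψr n).1.integrableOn
  have hvint : IntegrableOn (fun x => v x * W x) K :=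
    hmulint _ hv.aestronglyMeasurable.restrict hvr.integrableOn
  have hsupp : ∀ x, x ∉ K → |v x| ^ r = 0 := fun x hx => by
    have : v x = 0 := by
      by_contra h
      exact hx (hK (Metric.self_subset_cthickening _ (hvs h)))
    rw [this, abs_zero, Real.zero_rpow hrq.ne_zero]
  have hsum : ∀ f : X → ℝ, IntegrableOn (fun x => |f x| ^ r) K →
      IntegrableOn (fun x => |f x| ^ r + |W x| ^ q) K := fun f hf => hf.add hWq
  have hfatou := integral_le_of_tendsto_ae (μ := volume.restrict K)
    (f := fun n x => |ψ n x| ^ r + |W x| ^ q + ψ n x * W x)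
    (g := fun x => |v x| ^ r + |W x| ^ q + v x * W x)
    (C := (∫ x, |v x| ^ r) + ((∫ x in K, |W x| ^ q) + (B + L * ∑ i, ∫ x, |U i x| ^ p i)))
    (fun n => (hsum _ (hψr n).1.integrableOn).add (hψint n))
    (fun n x => by
      have h1 := abs_mul_le_rpow_add_rpow hrq (ψ n x) (W x)
      have h2 := neg_abs_le (ψ n x * W x)
      linarith)
    ((hsum _ hvr.integrableOn).add hvint)
    (by
      filter_upwards [ae_restrict_of_ae hψlim] with x hx
      exact ((hx.abs.rpow_const (Or.inr hrq.pos.le)).add_const _).add (hx.mul_const _))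
    (fun n => by
      rw [integral_add (hsum _ (hψr n).1.integrableOn) (hψint n),
        integral_add (hψr n).1.integrableOn hWq]
      have h1 : ∫ x in K, |ψ n x| ^ r ≤ ∫ x, |ψ n x| ^ r :=
        setIntegral_le_integral (hψr n).1
          (ae_of_all _ fun x => Real.rpow_nonneg (abs_nonneg _) _)
      have h2 := (hψr n).2
      have h3 := hψB n
      linarith)
  rw [integral_add (hsum _ hvr.integrableOn) hvint, integral_add hvr.integrableOn hWq,
    setIntegral_eq_integral_of_forall_compl_eq_zero hsupp] at hfatou
  linarith

end Mollification

/-! ### Measurability along Carathéodory functions -/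

/-- The composition of a Carathéodory function with a measurable function is measurable. -/
lemma aestronglyMeasurable_comp_of_caratheodory {Z V Y : Type*} [MeasurableSpace Z]
    [TopologicalSpace V] [NormedAddCommGroup Y] {μ : Measure Z}
    {f : Z → V → Y} (hf : ∀ v, AEStronglyMeasurable (fun z => f z v) μ)
    (hc : ∀ᵐ z ∂μ, Continuous (f z)) {g : Z → V} (hg : AEStronglyMeasurable g μ) :
    AEStronglyMeasurable (fun z => f z (g z)) μ := by
  classical
  let s := hg.stronglyMeasurable_mk.approx
  have hs : ∀ n, AEStronglyMeasurable (fun z => f z (s n z)) μ := fun n => by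
    have h1 : (fun z => f z (s n z))
        = ∑ v ∈ (s n).range, (s n ⁻¹' {v}).indicator (fun z => f z v) := by
      ext z
      rw [Finset.sum_apply, Finset.sum_eq_single (s n z)]
      · simp
      · intro v _ hv
        exact indicator_of_notMem (fun h => hv (by simpa using h.symm)) _
      · intro h
        exact absurd (SimpleFunc.mem_range_self _ _) h
    rw [h1]
    exact Finset.aestronglyMeasurable_sum _ fun v _ => (hf v).indicator ((s n).measurableSet_fiber v)
  refine aestronglyMeasurable_of_tendsto_ae atTop hs ?_
  filter_upwards [hc, hg.ae_eq_mk] with z hz1 hz2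
  rw [hz2]
  exact (hz1.tendsto _).comp (hg.stronglyMeasurable_mk.tendsto_approx z)

/-! ### The equation between two times -/

section TwoTimes

variable {N : ℕ}

lemma restrict_cylinder (K : Set (EuclideanSpace ℝ (Fin N))) (T : ℝ) :
    (volume : Measure (EuclideanSpace ℝ (Fin N) × ℝ)).restrict (cylinder K T)
      = (volume.restrict K).prod (volume.restrict (Ioo 0 T)) := by
  rw [_root_.cylinder, Measure.volume_eq_prod, Measure.prod_restrict]

lemma measurableSet_cylinder {K : Set (EuclideanSpace ℝ (Fin N))} (hK : MeasurableSet K) (T : ℝ) :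
    MeasurableSet (cylinder K T) := hK.prod measurableSet_Ioo

/-- Testing a conservation law with products of a function of `x` and a function of `t` gives the
evolution of the moments of the solution. -/
lemma exists_ae_moment_eq {Ω K : Set (EuclideanSpace ℝ (Fin N))} {T : ℝ} (hΩ : IsOpen Ω)
    (hT : 0 < T) (hK : IsCompact K) (hKΩ : K ⊆ Ω)
    {w : EuclideanSpace ℝ (Fin N) × ℝ → ℝ} {F : Fin N → EuclideanSpace ℝ (Fin N) × ℝ → ℝ}
    (hw : IntegrableOn w (cylinder K T)) (hF : ∀ i, IntegrableOn (F i) (cylinder K T))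
    (hweak : ∀ φ : EuclideanSpace ℝ (Fin N) × ℝ → ℝ, ContDiff ℝ ∞ φ → HasCompactSupport φ →
      tsupport φ ⊆ cylinder Ω T → ∫ z in cylinder Ω T,
        ((∑ i, F i z * fderiv ℝ φ z (EuclideanSpace.single i 1, 0))
          - w z * fderiv ℝ φ z (0, 1)) = 0)
    {ψ : EuclideanSpace ℝ (Fin N) → ℝ} (hψ : ContDiff ℝ ∞ ψ) (hψK : tsupport ψ ⊆ K) :
    ∃ c, ∀ᵐ t ∂(volume.restrict (Ioo 0 T)), ∫ x in K, ψ x * w (x, t)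
      = c - ∫ τ in (0 : ℝ)..t, ∫ x in K,
          ∑ i, F i (x, τ) * fderiv ℝ ψ x (EuclideanSpace.single i 1) := by
  have hψc : HasCompactSupport ψ := hK.of_isClosed_subset (isClosed_tsupport _) hψK
  have hdc : Continuous (fderiv ℝ ψ) := hψ.continuous_fderiv (by norm_cast)
  obtain ⟨C₀, hC₀⟩ := hψ.continuous.bounded_above_of_compact_support hψc
  obtain ⟨C₁, hC₁⟩ := hdc.bounded_above_of_compact_support (hψc.fderiv ℝ)
  have hwψ : Integrable (fun z : EuclideanSpace ℝ (Fin N) × ℝ => ψ z.1 * w z)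
      ((volume.restrict K).prod (volume.restrict (Ioo 0 T))) := by
    rw [← restrict_cylinder]
    exact hw.bdd_mul (c := C₀) (hψ.continuous.comp continuous_fst).aestronglyMeasurable
      (ae_of_all _ fun z => hC₀ z.1)
  have hFψ : Integrable (fun z : EuclideanSpace ℝ (Fin N) × ℝ =>
      ∑ i, F i z * fderiv ℝ ψ z.1 (EuclideanSpace.single i 1))
      ((volume.restrict K).prod (volume.restrict (Ioo 0 T))) := by
    rw [← restrict_cylinder]
    refine integrable_finsetSum _ fun i _ => ?_
    have hdi : Continuous (fun z : EuclideanSpace ℝ (Fin N) × ℝ =>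
        fderiv ℝ ψ z.1 (EuclideanSpace.single i 1)) := by fun_prop
    refine (hF i).mul_bdd (c := C₁) hdi.aestronglyMeasurable (ae_of_all _ fun z => ?_)
    refine (ContinuousLinearMap.le_opNorm _ _).trans ?_
    simpa using hC₁ z.1
  refine exists_ae_eq_sub_integral_of_weak_deriv hT hFψ.integral_prod_right
    hwψ.integral_prod_right fun θ h1 h2 h3 => ?_
  have hφd : ∀ z : EuclideanSpace ℝ (Fin N) × ℝ, HasFDerivAt
      (fun z : EuclideanSpace ℝ (Fin N) × ℝ => ψ z.1 * θ z.2)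
      (ψ z.1 • ((fderiv ℝ θ z.2).comp (ContinuousLinearMap.snd ℝ _ _))
        + θ z.2 • ((fderiv ℝ ψ z.1).comp (ContinuousLinearMap.fst ℝ _ _))) z := fun z => by
    have hd1 := ((hψ.differentiable (by norm_cast)) z.1).hasFDerivAt.comp z
      (hasFDerivAt_fst (𝕜 := ℝ) (p := z))
    have hd2 := ((h1.differentiable (by norm_cast)) z.2).hasFDerivAt.comp z
      (hasFDerivAt_snd (𝕜 := ℝ) (p := z))
    exact hd1.mul hd2
  have hts : tsupport (fun z : EuclideanSpace ℝ (Fin N) × ℝ => ψ z.1 * θ z.2)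
      ⊆ tsupport ψ ×ˢ tsupport θ := by
    refine closure_minimal (fun z hz => ⟨subset_tsupport _ ?_, subset_tsupport _ ?_⟩)
      ((isClosed_tsupport _).prod (isClosed_tsupport _))
    · exact left_ne_zero_of_mul hz
    · exact right_ne_zero_of_mul hz
  have htsK : tsupport (fun z : EuclideanSpace ℝ (Fin N) × ℝ => ψ z.1 * θ z.2) ⊆ cylinder K T :=
    hts.trans (prod_mono hψK h3)
  have hsub : cylinder K T ⊆ cylinder Ω T := prod_mono hKΩ subset_rfl
  have heq := hweak (fun z => ψ z.1 * θ z.2)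
    ((hψ.comp contDiff_fst).mul (h1.comp contDiff_snd))
    ((hψc.isCompact.prod h2.isCompact).of_isClosed_subset (isClosed_tsupport _) hts)
    (htsK.trans hsub)
  rw [setIntegral_eq_of_subset_of_forall_sdiff_eq_zero
    (measurableSet_cylinder hΩ.measurableSet T) hsub (fun z hz => by
      have hz0 : fderiv ℝ (fun z : EuclideanSpace ℝ (Fin N) × ℝ => ψ z.1 * θ z.2) z = 0 :=
        image_eq_zero_of_notMem_tsupport fun h => hz.2 (htsK (tsupport_fderiv_subset ℝ h))
      simp [hz0])] at heq
  simp only [(hφd _).fderiv] at heq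
  have hθb : ∀ θ' : ℝ → ℝ, Continuous θ' → HasCompactSupport θ' → ∀ f :
      EuclideanSpace ℝ (Fin N) × ℝ → ℝ,
      Integrable f ((volume.restrict K).prod (volume.restrict (Ioo 0 T))) →
      Integrable (fun z => θ' z.2 * f z) ((volume.restrict K).prod (volume.restrict (Ioo 0 T))) ∧
      ∫ z, θ' z.2 * f z ∂((volume.restrict K).prod (volume.restrict (Ioo 0 T)))
        = ∫ t in Ioo 0 T, θ' t * ∫ x in K, f (x, t) := fun θ' hc hs f hf => by
    obtain ⟨C, hC⟩ := hc.bounded_above_of_compact_support hs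
    have hi : Integrable (fun z => θ' z.2 * f z)
        ((volume.restrict K).prod (volume.restrict (Ioo 0 T))) :=
      hf.bdd_mul (c := C) (hc.comp continuous_snd).aestronglyMeasurable
        (ae_of_all _ fun z => hC z.2)
    refine ⟨hi, ?_⟩
    rw [integral_prod_symm _ hi]
    simp only [integral_const_mul]
  have hθ1 := hθb θ h1.continuous h2 _ hFψ
  have hθ2 := hθb (deriv θ) (h1.continuous_deriv (by norm_cast)) h2.deriv _ hwψ
  rw [← hθ1.2, ← hθ2.2, ← sub_eq_zero, ← integral_sub hθ1.1 hθ2.1]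
  rw [restrict_cylinder] at heq
  refine (integral_congr_ae (ae_of_all _ fun z => ?_)).trans heq
  simp only [add_apply, smul_apply,
    ContinuousLinearMap.comp_apply, ContinuousLinearMap.coe_fst', ContinuousLinearMap.coe_snd',
    map_zero, smul_eq_mul, mul_zero, zero_add, add_zero, fderiv_eq_smul_deriv, one_mul]
  rw [Finset.mul_sum]
  congr 1
  · exact Finset.sum_congr rfl fun i _ => by ring
  · ring

/-- Outside a null set of times, the conservation law holds between any two times, simultaneously
for all test functions. -/
lemma exists_ae_forall_two_times {Ω K : Set (EuclideanSpace ℝ (Fin N))} {T : ℝ} (hΩ : IsOpen Ω)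
    (hT : 0 < T) (hK : IsCompact K) (hKΩ : K ⊆ Ω)
    {w : EuclideanSpace ℝ (Fin N) × ℝ → ℝ} {F : Fin N → EuclideanSpace ℝ (Fin N) × ℝ → ℝ}
    (hw : IntegrableOn w (cylinder K T)) (hF : ∀ i, IntegrableOn (F i) (cylinder K T))
    (hweak : ∀ φ : EuclideanSpace ℝ (Fin N) × ℝ → ℝ, ContDiff ℝ ∞ φ → HasCompactSupport φ →
      tsupport φ ⊆ cylinder Ω T → ∫ z in cylinder Ω T,
        ((∑ i, F i z * fderiv ℝ φ z (EuclideanSpace.single i 1, 0))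
          - w z * fderiv ℝ φ z (0, 1)) = 0) :
    ∃ S : Set ℝ, (∀ᵐ t ∂(volume.restrict (Ioo 0 T)), t ∈ S) ∧ S ⊆ Ioo 0 T ∧
      ∀ s ∈ S, ∀ t ∈ S, s < t → ∀ ψ : EuclideanSpace ℝ (Fin N) → ℝ, ContDiff ℝ ∞ ψ →
        tsupport ψ ⊆ K → ∫ x in K, ψ x * (w (x, t) - w (x, s))
          = - ∫ z in K ×ˢ Ioo s t, ∑ i, F i z * fderiv ℝ ψ z.1 (EuclideanSpace.single i 1) := by
  obtain ⟨ψ, hψ, hdense⟩ := exists_seq_dense_test_functions hK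
  choose c hc using fun n => exists_ae_moment_eq hΩ hT hK hKΩ hw hF hweak (hψ n).1 (hψ n).2
  have hwi : ∀ᵐ t ∂(volume.restrict (Ioo 0 T)), Integrable (fun x => w (x, t)) (volume.restrict K) := by
    rw [IntegrableOn, restrict_cylinder] at hw
    exact hw.prod_left_ae
  refine ⟨{t | t ∈ Ioo 0 T ∧ Integrable (fun x => w (x, t)) (volume.restrict K) ∧
    ∀ n, ∫ x in K, ψ n x * w (x, t) = c n - ∫ τ in (0 : ℝ)..t, ∫ x in K,
          ∑ i, F i (x, τ) * fderiv ℝ (ψ n) x (EuclideanSpace.single i 1)}, ?_,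
    fun t ht => ht.1, ?_⟩
  · filter_upwards [ae_restrict_mem measurableSet_Ioo, hwi, ae_all_iff.2 hc] with t h1 h2 h3
      using ⟨h1, h2, h3⟩
  rintro s ⟨hs1, hs2, hs3⟩ t ⟨ht1, ht2, ht3⟩ hst φ hφ hφK
  have hsubI : Ioo s t ⊆ Ioo 0 T := Ioo_subset_Ioo hs1.1.le ht1.2.le
  have hFst : ∀ i, IntegrableOn (F i) (K ×ˢ Ioo s t) := fun i =>
    (hF i).mono_set (prod_mono subset_rfl hsubI)
  have hW : Integrable (fun x => w (x, t) - w (x, s)) (volume.restrict K) := ht2.sub hs2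
  -- products with test functions are integrable
  have hmulW : ∀ ζ : EuclideanSpace ℝ (Fin N) → ℝ, ContDiff ℝ ∞ ζ → tsupport ζ ⊆ K →
      ∀ f : EuclideanSpace ℝ (Fin N) → ℝ, Integrable f (volume.restrict K) →
      Integrable (fun x => ζ x * f x) (volume.restrict K) := by
    intro ζ h1 h2 f hf
    obtain ⟨C, hC⟩ := h1.continuous.bounded_above_of_compact_support
      (hK.of_isClosed_subset (isClosed_tsupport _) h2)
    exact hf.bdd_mul (c := C) h1.continuous.aestronglyMeasurable (ae_of_all _ hC)
  have hmulF : ∀ ζ : EuclideanSpace ℝ (Fin N) → ℝ, ContDiff ℝ ∞ ζ → tsupport ζ ⊆ K →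
      ∀ Q : Set (EuclideanSpace ℝ (Fin N) × ℝ), (∀ i, IntegrableOn (F i) Q) →
      IntegrableOn (fun z : EuclideanSpace ℝ (Fin N) × ℝ =>
        ∑ i, F i z * fderiv ℝ ζ z.1 (EuclideanSpace.single i 1)) Q := by
    intro ζ h1 h2 Q hQ
    have hdc : Continuous (fderiv ℝ ζ) := h1.continuous_fderiv (by norm_cast)
    have hζc : HasCompactSupport ζ := hK.of_isClosed_subset (isClosed_tsupport _) h2
    obtain ⟨C, hC⟩ := hdc.bounded_above_of_compact_support (hζc.fderiv ℝ)
    refine integrable_finsetSum _ fun i _ => ?_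
    have hdi : Continuous (fun z : EuclideanSpace ℝ (Fin N) × ℝ =>
        fderiv ℝ ζ z.1 (EuclideanSpace.single i 1)) := by fun_prop
    refine (hQ i).mul_bdd (c := C) hdi.aestronglyMeasurable (ae_of_all _ fun z => ?_)
    refine (ContinuousLinearMap.le_opNorm _ _).trans ?_
    simpa using hC z.1
  -- the claim for the countable family
  have hn : ∀ n, ∫ x in K, ψ n x * (w (x, t) - w (x, s))
      = - ∫ z in K ×ˢ Ioo s t,
        ∑ i, F i z * fderiv ℝ (ψ n) z.1 (EuclideanSpace.single i 1) := by
    intro n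
    have h1 := hmulF (ψ n) (hψ n).1 (hψ n).2 (cylinder K T) hF
    rw [IntegrableOn, restrict_cylinder] at h1
    have h2 : IntegrableOn _ (Ioo 0 T) := h1.integral_prod_right
    have h3 : ∀ r ∈ Ioo 0 T, IntervalIntegrable (fun τ => ∫ x in K,
        ∑ i, F i (x, τ) * fderiv ℝ (ψ n) x (EuclideanSpace.single i 1)) volume 0 r := by
      intro r hr
      rw [intervalIntegrable_iff_integrableOn_Ioo_of_le hr.1.le]
      exact h2.mono_set (Ioo_subset_Ioo le_rfl hr.2.le)
    have h4 := hmulF (ψ n) (hψ n).1 (hψ n).2 (K ×ˢ Ioo s t) hFst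
    have h5 : (volume : Measure (EuclideanSpace ℝ (Fin N) × ℝ)).restrict (K ×ˢ Ioo s t)
        = (volume.restrict K).prod (volume.restrict (Ioo s t)) := by
      rw [Measure.volume_eq_prod, Measure.prod_restrict]
    rw [IntegrableOn, h5] at h4
    rw [h5, integral_prod_symm _ h4, ← integral_Ioc_eq_integral_Ioo,
      ← intervalIntegral.integral_of_le hst.le,
      ← intervalIntegral.integral_interval_sub_left (h3 t ht1) (h3 s hs1)]
    simp only [mul_sub]
    rw [integral_sub (hmulW _ (hψ n).1 (hψ n).2 _ ht2) (hmulW _ (hψ n).1 (hψ n).2 _ hs2),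
      ht3 n, hs3 n]
    ring
  -- the defect of the equation is continuous in the test function
  set D : ℝ := (∫ x in K, |w (x, t) - w (x, s)|) + ∫ z in K ×ˢ Ioo s t, ∑ i, |F i z| with hD
  have hD0 : 0 ≤ D := add_nonneg (integral_nonneg fun _ => abs_nonneg _)
    (integral_nonneg fun _ => Finset.sum_nonneg fun _ _ => abs_nonneg _)
  have hbound : ∀ ε > 0, |(∫ x in K, φ x * (w (x, t) - w (x, s))) + ∫ z in K ×ˢ Ioo s t,
      ∑ i, F i z * fderiv ℝ φ z.1 (EuclideanSpace.single i 1)| ≤ ε * D := by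
    intro ε hε
    obtain ⟨n, hnε⟩ := hdense φ hφ hφK ε hε
    have e1 : (∫ x in K, φ x * (w (x, t) - w (x, s))) + ∫ z in K ×ˢ Ioo s t,
        ∑ i, F i z * fderiv ℝ φ z.1 (EuclideanSpace.single i 1)
        = -((∫ x in K, (ψ n x * (w (x, t) - w (x, s)) - φ x * (w (x, t) - w (x, s))))
        + ∫ z in K ×ˢ Ioo s t, ((∑ i, F i z * fderiv ℝ (ψ n) z.1 (EuclideanSpace.single i 1))
          - ∑ i, F i z * fderiv ℝ φ z.1 (EuclideanSpace.single i 1))) := by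
      rw [integral_sub (hmulW _ (hψ n).1 (hψ n).2 _ hW) (hmulW _ hφ hφK _ hW),
        integral_sub (hmulF _ (hψ n).1 (hψ n).2 _ hFst) (hmulF _ hφ hφK _ hFst), hn n]
      ring
    have b1 : |∫ x in K, (ψ n x * (w (x, t) - w (x, s)) - φ x * (w (x, t) - w (x, s)))|
        ≤ ε * ∫ x in K, |w (x, t) - w (x, s)| := by
      rw [← integral_const_mul, ← Real.norm_eq_abs]
      refine norm_integral_le_of_norm_le (hW.abs.const_mul ε) (ae_of_all _ fun x => ?_)
      rw [← sub_mul, norm_mul, Real.norm_eq_abs, Real.norm_eq_abs]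
      exact mul_le_mul_of_nonneg_right (hnε x).1 (abs_nonneg _)
    have b2 : |∫ z in K ×ˢ Ioo s t,
        ((∑ i, F i z * fderiv ℝ (ψ n) z.1 (EuclideanSpace.single i 1))
          - ∑ i, F i z * fderiv ℝ φ z.1 (EuclideanSpace.single i 1))|
        ≤ ε * ∫ z in K ×ˢ Ioo s t, ∑ i, |F i z| := by
      rw [← integral_const_mul, ← Real.norm_eq_abs]
      refine norm_integral_le_of_norm_le
        ((integrable_finsetSum _ fun i _ => (hFst i).abs).const_mul ε) (ae_of_all _ fun z => ?_)
      rw [← Finset.sum_sub_distrib, Finset.mul_sum]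
      refine (norm_sum_le _ _).trans (Finset.sum_le_sum fun i _ => ?_)
      rw [← mul_sub, norm_mul, mul_comm, Real.norm_eq_abs (F i z)]
      refine mul_le_mul_of_nonneg_right ?_ (abs_nonneg _)
      rw [← sub_apply]
      refine (ContinuousLinearMap.le_opNorm _ _).trans ?_
      simpa using (hnε z.1).2
    rw [e1, abs_neg, hD, mul_add]
    exact (abs_add_le _ _).trans (add_le_add b1 b2)
  have hzero : |(∫ x in K, φ x * (w (x, t) - w (x, s))) + ∫ z in K ×ˢ Ioo s t,
      ∑ i, F i z * fderiv ℝ φ z.1 (EuclideanSpace.single i 1)| ≤ 0 := by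
    refine le_of_forall_pos_le_add fun ε hε => ?_
    refine (hbound (ε / (D + 1)) (by positivity)).trans ?_
    rw [zero_add, div_mul_eq_mul_div, div_le_iff₀ (by linarith)]
    nlinarith
  linarith [abs_nonpos_iff.1 hzero]

end TwoTimes

/-! ### From energy estimates to a modulus of continuity -/

/-- If the increments of `t ↦ w t` are controlled when tested with `|w r| ^ (q - 2) w r`, the
derivative of `|·| ^ q / q` at `w r`, for the time `r` either at an end point or in between, then
they are controlled in `L ^ q`. Convexity turns the hypothesis into bounds for the increments of
the energy `∫ |w t| ^ q`, which chaining makes uniform; uniform convexity, applied at an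
intermediate time `r` where `m r` is not larger than average, gives the conclusion. -/
lemma integral_abs_sub_rpow_le_of_energy {X : Type*} [MeasurableSpace X] {ν : Measure X}
    {q : ℝ} (hq : 2 ≤ q) {w : ℝ → X → ℝ} {S : Set ℝ} {m M : ℝ → ℝ} {T : ℝ} (hST : S ⊆ Ioo 0 T)
    (hsel : ∀ c d, 0 ≤ c → c < d → d ≤ T → ∃ r ∈ S, c < r ∧ r < d ∧ (d - c) * m r ≤ M d - M c)
    (hm : ∀ t, 0 ≤ m t) (hwm : ∀ t ∈ S, AEStronglyMeasurable (w t) ν)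
    (hwq : ∀ t ∈ S, Integrable (fun x => |w t x| ^ q) ν)
    (hkey : ∀ s ∈ S, ∀ t ∈ S, s < t → ∀ r ∈ S,
      |∫ x, signedPow (q - 1) (w r x) * (w t x - w s x) ∂ν| ≤ M t - M s + (t - s) * m r)
    {s t : ℝ} (hs : s ∈ S) (ht : t ∈ S) (hst : s < t) :
    ∫ x, |w t x - w s x| ^ q ∂ν ≤ 2 * 4 ^ q * q * (M t - M s) := by
  have hq0 : (0 : ℝ) < q := by linarith
  have hq1 : (1 : ℝ) < q := by linarith
  have hmulint : ∀ r ∈ S, ∀ t ∈ S,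
      Integrable (fun x => signedPow (q - 1) (w r x) * w t x) ν := fun r hr t ht => by
    refine ((hwq r hr).add (hwq t ht)).mono'
      (((measurable_signedPow _).comp_aemeasurable (hwm r hr).aemeasurable).aestronglyMeasurable.mul
        (hwm t ht)) (ae_of_all _ fun x => ?_)
    refine (abs_mul_le_rpow_add_rpow (Real.HolderConjugate.conjExponent hq1).symm _ _).trans
      (le_of_eq ?_)
    rw [abs_signedPow (by linarith), ← Real.rpow_mul (abs_nonneg _), Real.conjExponent,
      mul_div_cancel₀ q (by linarith : q - 1 ≠ 0)]
    rfl
  have hdint : ∀ r ∈ S, ∀ t ∈ S, ∀ s ∈ S,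
      Integrable (fun x => signedPow (q - 1) (w r x) * (w t x - w s x)) ν :=
    fun r hr t ht s hs => by
      simp only [mul_sub]
      exact (hmulint r hr t ht).sub (hmulint r hr s hs)
  have hneg : ∀ r s t, ∫ x, signedPow (q - 1) (w r x) * (w s x - w t x) ∂ν
      = -∫ x, signedPow (q - 1) (w r x) * (w t x - w s x) ∂ν := fun r s t => by
    rw [← integral_neg]
    congr 1
    ext x
    ring
  -- integrated tangent inequality and its uniform version
  have hsubq : ∀ t ∈ S, ∀ s ∈ S, Integrable (fun x => |w t x| ^ q - |w s x| ^ q) ν :=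
    fun t ht s hs => (hwq t ht).sub (hwq s hs)
  have hgap : ∀ r ∈ S, ∀ t ∈ S, Integrable (fun x => |w t x| ^ q - |w r x| ^ q
      - q * (signedPow (q - 1) (w r x) * (w t x - w r x))) ν := fun r hr t ht =>
    (hsubq t ht r hr).sub ((hdint r hr t ht r hr).const_mul q)
  have hgapint : ∀ r ∈ S, ∀ t ∈ S, ∫ x, (|w t x| ^ q - |w r x| ^ q
      - q * (signedPow (q - 1) (w r x) * (w t x - w r x))) ∂ν
      = ∫ x, |w t x| ^ q ∂ν - ∫ x, |w r x| ^ q ∂ν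
        - q * ∫ x, signedPow (q - 1) (w r x) * (w t x - w r x) ∂ν := fun r hr t ht => by
    rw [integral_sub (hsubq t ht r hr) ((hdint r hr t ht r hr).const_mul q),
      integral_sub (hwq t ht) (hwq r hr), integral_const_mul]
  have htan : ∀ r ∈ S, ∀ t ∈ S, q * ∫ x, signedPow (q - 1) (w r x) * (w t x - w r x) ∂ν
      ≤ ∫ x, |w t x| ^ q ∂ν - ∫ x, |w r x| ^ q ∂ν := fun r hr t ht => by
    have h1 : 0 ≤ ∫ x, (|w t x| ^ q - |w r x| ^ q
        - q * (signedPow (q - 1) (w r x) * (w t x - w r x))) ∂ν :=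
      integral_nonneg fun x => (mul_nonneg two_pos.le (Real.rpow_nonneg (abs_nonneg _) _)).trans
        (uniformConvex_abs_rpow hq (w t x) (w r x))
    rw [hgapint r hr t ht] at h1
    linarith
  have hE : ∀ s ∈ S, ∀ t ∈ S, s < t → |∫ x, |w t x| ^ q ∂ν - ∫ x, |w s x| ^ q ∂ν|
      ≤ q * M t - q * M s + (t - s) * (q * m s + q * m t) := by
    intro s hs t ht hst
    have h1 := htan s hs t ht
    have h2 := htan t ht s hs
    rw [hneg] at h2
    have h3 := abs_le.1 (hkey s hs t ht hst s hs)
    have h4 := abs_le.1 (hkey s hs t ht hst t ht)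
    have h5 := mul_le_mul_of_nonneg_left h3.1 hq0.le
    have h6 := mul_le_mul_of_nonneg_left h4.2 hq0.le
    have h7 : 0 ≤ q * ((t - s) * m s) :=
      mul_nonneg hq0.le (mul_nonneg (sub_nonneg.2 hst.le) (hm s))
    have h8 : 0 ≤ q * ((t - s) * m t) :=
      mul_nonneg hq0.le (mul_nonneg (sub_nonneg.2 hst.le) (hm t))
    rw [abs_le]
    constructor <;> linarith
  have hchain : ∀ s ∈ S, ∀ t ∈ S, s < t → |∫ x, |w t x| ^ q ∂ν - ∫ x, |w s x| ^ q ∂ν|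
      ≤ 5 * (q * M t - q * M s) := fun s hs t ht hst =>
    abs_sub_le_of_chain (E := fun t => ∫ x, |w t x| ^ q ∂ν) (m := fun t => q * m t)
      (M := fun t => q * M t) hST
      (fun c d hc hcd hd => by
        obtain ⟨r, h1, h2, h3, h4⟩ := hsel c d hc hcd hd
        refine ⟨r, h1, h2, h3, ?_⟩
        have h5 := mul_le_mul_of_nonneg_left h4 hq0.le
        linarith)
      (fun t => mul_nonneg hq0.le (hm t)) hE hs ht hst
  -- comparison with an intermediate time
  obtain ⟨r, hr, hsr, hrt, hrm⟩ := hsel s t (hST hs).1.le hst (hST ht).2.le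
  have hpt : ∀ x, 4 * 4⁻¹ ^ q * |w t x - w s x| ^ q
      ≤ (|w t x| ^ q - |w r x| ^ q - q * (signedPow (q - 1) (w r x) * (w t x - w r x)))
      + (|w s x| ^ q - |w r x| ^ q - q * (signedPow (q - 1) (w r x) * (w s x - w r x))) := by
    intro x
    have h1 := uniformConvex_abs_rpow hq (w t x) (w r x)
    have h2 := uniformConvex_abs_rpow hq (w s x) (w r x)
    have h3 := abs_half_sub_rpow_le hq1.le (w t x / 2) (w s x / 2) (w r x / 2)
    have h4 : |(w t x / 2 - w s x / 2) / 2| ^ q = 4⁻¹ ^ q * |w t x - w s x| ^ q := by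
      rw [← Real.mul_rpow (by norm_num) (abs_nonneg _)]
      congr 1
      rw [show (w t x / 2 - w s x / 2) / 2 = 4⁻¹ * (w t x - w s x) by ring, abs_mul]
      norm_num
    rw [h4, ← sub_div, ← sub_div] at h3
    linarith
  have hle : 4 * 4⁻¹ ^ q * ∫ x, |w t x - w s x| ^ q ∂ν
      ≤ (∫ x, |w t x| ^ q ∂ν - ∫ x, |w r x| ^ q ∂ν
        - q * ∫ x, signedPow (q - 1) (w r x) * (w t x - w r x) ∂ν)
      + (∫ x, |w s x| ^ q ∂ν - ∫ x, |w r x| ^ q ∂ν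
        - q * ∫ x, signedPow (q - 1) (w r x) * (w s x - w r x) ∂ν) := by
    rw [← integral_const_mul, ← hgapint r hr t ht, ← hgapint r hr s hs,
      ← integral_add (hgap r hr t ht) (hgap r hr s hs)]
    exact integral_mono_of_nonneg (ae_of_all _ fun x => by positivity)
      ((hgap r hr t ht).add (hgap r hr s hs)) (ae_of_all _ hpt)
  rw [hneg r s r] at hle
  have h1 := (abs_le.1 (hchain s hs r hr hsr)).1
  have h2 := (abs_le.1 (hchain r hr t ht hrt)).2
  have h3 := mul_le_mul_of_nonneg_left (abs_le.1 (hkey s hs r hr hsr r hr)).2 hq0.le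
  have h4 := mul_le_mul_of_nonneg_left (abs_le.1 (hkey r hr t ht hrt r hr)).1 hq0.le
  have h5 := mul_le_mul_of_nonneg_left hrm hq0.le
  have h6 : 4 * 4⁻¹ ^ q * ∫ x, |w t x - w s x| ^ q ∂ν ≤ 7 * (q * (M t - M s)) := by linarith
  have h7 : (4 : ℝ) ^ q * 4⁻¹ ^ q = 1 := by
    rw [← Real.mul_rpow (by norm_num) (by norm_num)]; norm_num
  have h8 := mul_le_mul_of_nonneg_left h6 (by positivity : (0 : ℝ) ≤ 4 ^ q / 4)
  have h9 : (4 : ℝ) ^ q / 4 * (4 * 4⁻¹ ^ q * ∫ x, |w t x - w s x| ^ q ∂ν)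
      = ∫ x, |w t x - w s x| ^ q ∂ν := by
    linear_combination (∫ x, |w t x - w s x| ^ q ∂ν) * h7
  rw [h9] at h8
  have h10 : 0 ≤ (4 : ℝ) ^ q * (q * (M t - M s)) := by
    have h11 : 0 ≤ (t - s) * m r := mul_nonneg (sub_nonneg.2 hst.le) (hm r)
    have h12 : 0 ≤ M t - M s := h11.trans hrm
    positivity
  linarith

/-! ### The anisotropic structure conditions -/

lemma rpow_conj_mul_abs_le {S p : ℝ} (hS : 0 ≤ S) (hp : 1 < p) (y : ℝ) :
    S ^ ((p - 1) / p) * |y| ≤ S + |y| ^ p := by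
  have h := abs_mul_le_rpow_add_rpow (Real.HolderConjugate.conjExponent hp).symm
    (S ^ ((p - 1) / p)) y
  have hp0 : p ≠ 0 := by linarith
  have hp1 : p - 1 ≠ 0 := by linarith
  rw [abs_mul, abs_of_nonneg (Real.rpow_nonneg hS _), ← Real.rpow_mul hS, Real.conjExponent,
    div_mul_div_cancel₀ hp0, div_self hp1, Real.rpow_one] at h
  exact h

lemma abs_sum_mul_le_of_growth {N : ℕ} {p F y : Fin N → ℝ} {Λ S : ℝ} (hΛ : 0 ≤ Λ) (hS : 0 ≤ S)
    (hp : ∀ i, 1 < p i) (hF : ∀ i, |F i| ≤ Λ * S ^ ((p i - 1) / p i)) :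
    |∑ i, F i * y i| ≤ N * Λ * S + Λ * ∑ i, |y i| ^ p i := by
  calc |∑ i, F i * y i| ≤ ∑ i, |F i * y i| := Finset.abs_sum_le_sum_abs _ _
    _ ≤ ∑ i, (Λ * S + Λ * |y i| ^ p i) := by
        refine Finset.sum_le_sum fun i _ => ?_
        rw [abs_mul]
        have h1 := mul_le_mul_of_nonneg_right (hF i) (abs_nonneg (y i))
        have h2 := mul_le_mul_of_nonneg_left (rpow_conj_mul_abs_le hS (hp i) (y i)) hΛ
        linarith
    _ = _ := by
        rw [Finset.sum_add_distrib, Finset.mul_sum, Finset.sum_const, Finset.card_univ,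
          Fintype.card_fin, nsmul_eq_mul]
        ring

/-! ### The energy estimate between two times -/

section Energy

variable {N : ℕ}

lemma restrict_prod_Ioo (K : Set (EuclideanSpace ℝ (Fin N))) (s t : ℝ) :
    (volume : Measure (EuclideanSpace ℝ (Fin N) × ℝ)).restrict (K ×ˢ Ioo s t)
      = (volume.restrict K).prod (volume.restrict (Ioo s t)) := by
  rw [Measure.volume_eq_prod, Measure.prod_restrict]

/-- The conservation law between two times, tested with a Sobolev function. -/
lemma abs_setIntegral_mul_le_of_two_times {p : Fin N → ℝ} (hp : ∀ i, 1 < p i) {Λ : ℝ} (hΛ : 0 ≤ Λ)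
    {K₀ K : Set (EuclideanSpace ℝ (Fin N))} {δ : ℝ} (hδ : 0 < δ) (hK₀ : IsCompact K₀)
    (hK : Metric.cthickening δ K₀ ⊆ K) {r q : ℝ} (hrq : r.HolderConjugate q)
    {s t : ℝ} (hst : s < t) {W : EuclideanSpace ℝ (Fin N) → ℝ}
    {F : Fin N → EuclideanSpace ℝ (Fin N) × ℝ → ℝ} {D : EuclideanSpace ℝ (Fin N) × ℝ → ℝ}
    (hFD : ∀ᵐ z ∂(volume.restrict (K ×ˢ Ioo s t)), ∀ y : Fin N → ℝ,
      |∑ i, F i z * y i| ≤ D z + Λ * ∑ i, |y i| ^ p i)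
    (hD : IntegrableOn D (K ×ˢ Ioo s t))
    (hWm : AEStronglyMeasurable W (volume.restrict K))
    (hWq : IntegrableOn (fun x => |W x| ^ q) K)
    (hW : ∀ ψ : EuclideanSpace ℝ (Fin N) → ℝ, ContDiff ℝ ∞ ψ → tsupport ψ ⊆ K →
      ∫ x in K, ψ x * W x
        = - ∫ z in K ×ˢ Ioo s t, ∑ i, F i z * fderiv ℝ ψ z.1 (EuclideanSpace.single i 1))
    {v : EuclideanSpace ℝ (Fin N) → ℝ} {U : Fin N → EuclideanSpace ℝ (Fin N) → ℝ}
    (hvs : Function.support v ⊆ K₀) (hv : Integrable v)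
    (hvr : Integrable (fun x => |v x| ^ r)) (hU : ∀ i, Integrable (U i))
    (hUp : ∀ i, Integrable (fun x => |U i x| ^ p i))
    (hweak : ∀ i, ∀ φ : EuclideanSpace ℝ (Fin N) → ℝ, ContDiff ℝ ∞ φ → HasCompactSupport φ →
      ∫ x, v x * fderiv ℝ φ x (EuclideanSpace.single i 1) = - ∫ x, U i x * φ x) :
    |∫ x in K, v x * W x|
      ≤ (∫ z in K ×ˢ Ioo s t, D z) + ((t - s) * Λ) * ∑ i, ∫ x, |U i x| ^ p i := by
  have hL : 0 ≤ (t - s) * Λ := mul_nonneg (sub_nonneg.2 hst.le) hΛ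
  have hψ : ∀ ψ : EuclideanSpace ℝ (Fin N) → ℝ, ContDiff ℝ ∞ ψ → tsupport ψ ⊆ K →
      (∀ i, Integrable (fun x => |fderiv ℝ ψ x (EuclideanSpace.single i 1)| ^ p i)) →
      |∫ x in K, ψ x * W x| ≤ (∫ z in K ×ˢ Ioo s t, D z)
        + ((t - s) * Λ) * ∑ i, ∫ x, |fderiv ℝ ψ x (EuclideanSpace.single i 1)| ^ p i := by
    intro ψ h1 h2 h3
    have hsum : Integrable (fun x => ∑ i, |fderiv ℝ ψ x (EuclideanSpace.single i 1)| ^ p i)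
        (volume.restrict K) := integrable_finsetSum _ fun i _ => (h3 i).integrableOn
    have hsum' : IntegrableOn (fun z : EuclideanSpace ℝ (Fin N) × ℝ =>
        Λ * ∑ i, |fderiv ℝ ψ z.1 (EuclideanSpace.single i 1)| ^ p i) (K ×ˢ Ioo s t) := by
      rw [IntegrableOn, restrict_prod_Ioo]
      exact (hsum.comp_fst _).const_mul Λ
    rw [hW ψ h1 h2, abs_neg, ← Real.norm_eq_abs]
    refine (norm_integral_le_of_norm_le (hD.add hsum') ?_).trans ?_
    · filter_upwards [hFD] with z hz using hz _
    · simp only [Pi.add_apply]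
      rw [integral_add hD hsum', integral_const_mul, restrict_prod_Ioo,
        integral_fun_fst (fun x => ∑ i, |fderiv ℝ ψ x (EuclideanSpace.single i 1)| ^ p i)]
      simp only [Measure.real, Measure.restrict_apply_univ, Real.volume_Ioo, smul_eq_mul,
        ENNReal.toReal_ofReal (sub_nonneg.2 hst.le)]
      have h4 : ∫ x in K, ∑ i, |fderiv ℝ ψ x (EuclideanSpace.single i 1)| ^ p i
          ≤ ∑ i, ∫ x, |fderiv ℝ ψ x (EuclideanSpace.single i 1)| ^ p i := by
        rw [integral_finsetSum _ fun i _ => (h3 i).integrableOn]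
        exact Finset.sum_le_sum fun i _ => setIntegral_le_integral (h3 i)
          (ae_of_all _ fun x => Real.rpow_nonneg (abs_nonneg _) _)
      have h5 := mul_le_mul_of_nonneg_left h4 hL
      linarith
  rw [abs_le']
  constructor
  · exact setIntegral_mul_le_of_forall_test_function hp hδ hK₀ hK hrq hvs hv hvr hU hUp hweak
      hWm hWq hL fun ψ h1 _ h2 h3 => (le_abs_self _).trans (hψ ψ h1 h2 h3)
  · have h := setIntegral_mul_le_of_forall_test_function hp hδ hK₀ hK hrq hvs hv hvr hU hUp hweak
      (W := fun x => -W x) hWm.neg (by simpa only [abs_neg] using hWq) hL fun ψ h1 _ h2 h3 => by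
        simp only [mul_neg, integral_neg]
        exact (neg_le_abs _).trans (hψ ψ h1 h2 h3)
    simpa only [mul_neg, integral_neg] using h

/-- The product rule for a weak gradient and a cutoff function. -/
lemma HasWeakGradient.integral_cutoff_mul {Ω : Set (EuclideanSpace ℝ (Fin N))}
    {f : EuclideanSpace ℝ (Fin N) → ℝ} {g : EuclideanSpace ℝ (Fin N) → EuclideanSpace ℝ (Fin N)}
    (hfg : HasWeakGradient Ω f g) {η : EuclideanSpace ℝ (Fin N) → ℝ} (hη : ContDiff ℝ ∞ η)
    (hηc : HasCompactSupport η) (hηΩ : tsupport η ⊆ Ω) (i : Fin N)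
    {φ : EuclideanSpace ℝ (Fin N) → ℝ} (hφ : ContDiff ℝ ∞ φ) :
    ∫ x, (η x * f x) * fderiv ℝ φ x (EuclideanSpace.single i 1)
      = - ∫ x, (η x * g x i + fderiv ℝ η x (EuclideanSpace.single i 1) * f x) * φ x := by
  have hηd : Continuous fun x => fderiv ℝ η x (EuclideanSpace.single i 1) := by
    have := hη.continuous_fderiv (by norm_cast)
    fun_prop
  have hφd : Continuous fun x => fderiv ℝ φ x (EuclideanSpace.single i 1) := by
    have := hφ.continuous_fderiv (by norm_cast)
    fun_prop
  have hη0 : ∀ x, x ∉ tsupport η → η x = 0 := fun x hx => image_eq_zero_of_notMem_tsupport hx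
  have hηd0 : ∀ x, x ∉ tsupport η → fderiv ℝ η x = 0 := fun x hx =>
    image_eq_zero_of_notMem_tsupport fun h => hx (tsupport_fderiv_subset ℝ h)
  -- products with continuous functions supported in the support of the cutoff are integrable
  have hint : ∀ h : EuclideanSpace ℝ (Fin N) → ℝ, IntegrableOn h (tsupport η) →
      ∀ ζ : EuclideanSpace ℝ (Fin N) → ℝ, Continuous ζ → (∀ x, x ∉ tsupport η → ζ x = 0) →
      Integrable (fun x => h x * ζ x) := by
    intro h hh ζ hζ hζ0
    have hs : Function.support (fun x => h x * ζ x) ⊆ tsupport η := fun x hx => by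
      by_contra hc
      exact hx (by simp [hζ0 x hc])
    rw [← integrableOn_iff_integrable_of_support_subset hs]
    obtain ⟨C, hC⟩ := hζ.bounded_above_of_compact_support
      (HasCompactSupport.intro hηc fun x hx => hζ0 x hx)
    exact hh.mul_bdd (c := C) hζ.aestronglyMeasurable (ae_of_all _ hC)
  have hfi : IntegrableOn f (tsupport η) := hfg.integrable _ hηΩ hηc
  have hgi : IntegrableOn (fun x => g x i) (tsupport η) :=
    (EuclideanSpace.proj (𝕜 := ℝ) i).integrable_comp (hfg.integrable_grad _ hηΩ hηc)
  have hts : tsupport (fun x => η x * φ x) ⊆ tsupport η :=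
    closure_mono fun x hx => left_ne_zero_of_mul hx
  have heq := hfg.integral_eq (fun x => η x * φ x) (hη.mul hφ) hηc.mul_right (hts.trans hηΩ) i
  have hd : ∀ x, fderiv ℝ (fun x => η x * φ x) x (EuclideanSpace.single i 1)
      = η x * fderiv ℝ φ x (EuclideanSpace.single i 1)
        + φ x * fderiv ℝ η x (EuclideanSpace.single i 1) := fun x => by
    rw [fderiv_fun_mul (hη.differentiable (by norm_cast) x) (hφ.differentiable (by norm_cast) x)]
    simp
  simp only [hd] at heq
  rw [setIntegral_eq_integral_of_forall_compl_eq_zero (fun x hx => by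
      have hx' : x ∉ tsupport η := fun h => hx (hηΩ h)
      simp [hη0 x hx', hηd0 x hx']),
    setIntegral_eq_integral_of_forall_compl_eq_zero (fun x hx => by
      have hx' : x ∉ tsupport η := fun h => hx (hηΩ h)
      simp [hη0 x hx'])] at heq
  have i1 := hint f hfi (fun x => η x * fderiv ℝ φ x (EuclideanSpace.single i 1))
    (hη.continuous.mul hφd) fun x hx => by simp [hη0 x hx]
  have i2 := hint f hfi (fun x => φ x * fderiv ℝ η x (EuclideanSpace.single i 1))
    (hφ.continuous.mul hηd) fun x hx => by simp [hηd0 x hx]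
  have i3 := hint _ hgi (fun x => η x * φ x) (hη.continuous.mul hφ.continuous)
    fun x hx => by simp [hη0 x hx]
  simp only [mul_add] at heq
  rw [integral_add i1 i2] at heq
  have e1 : ∫ x, (η x * f x) * fderiv ℝ φ x (EuclideanSpace.single i 1)
      = ∫ x, f x * (η x * fderiv ℝ φ x (EuclideanSpace.single i 1)) := by
    congr 1; ext x; ring
  have e2 : ∫ x, (η x * g x i + fderiv ℝ η x (EuclideanSpace.single i 1) * f x) * φ x
      = ∫ x, (g x i * (η x * φ x) + f x * (φ x * fderiv ℝ η x (EuclideanSpace.single i 1))) := by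
    congr 1; ext x; ring
  rw [e1, e2, integral_add i3 i2]
  linarith

/-- A smooth cutoff function for a compact subset of an open set. -/
lemma exists_smooth_cutoff {Ω C : Set (EuclideanSpace ℝ (Fin N))} (hΩ : IsOpen Ω)
    (hC : IsCompact C) (hCΩ : C ⊆ Ω) :
    ∃ η : EuclideanSpace ℝ (Fin N) → ℝ, ContDiff ℝ ∞ η ∧ HasCompactSupport η ∧ tsupport η ⊆ Ω ∧
      (∀ x ∈ C, η x = 1) ∧ ∀ x, η x ∈ Icc (0 : ℝ) 1 := by
  obtain ⟨K, hK, hCK, hKΩ⟩ := exists_compact_between hC hΩ hCΩ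
  obtain ⟨f, hf1, hf0, hf⟩ := exists_contMDiffMap_one_nhds_of_subset_interior
    (modelWithCornersSelf ℝ (EuclideanSpace ℝ (Fin N))) (n := ⊤) hC.isClosed hCK
  have hts : tsupport f ⊆ K := closure_minimal (fun x hx => by
    by_contra h
    exact hx (hf0 x h)) hK.isClosed
  refine ⟨f, f.contMDiff.contDiff, hK.of_isClosed_subset (isClosed_tsupport _) hts,
    hts.trans hKΩ, fun x hx => ?_, hf⟩
  exact hf1.self_of_nhdsSet x hx

end Energy

/-! ### Continuity modulus of weak solutions -/

section Modulus

variable {N : ℕ}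

lemma isFiniteMeasure_restrict_cylinder {K : Set (EuclideanSpace ℝ (Fin N))} (hK : IsCompact K)
    (T : ℝ) : IsFiniteMeasure
      ((volume : Measure (EuclideanSpace ℝ (Fin N) × ℝ)).restrict (cylinder K T)) := by
  have : IsFiniteMeasure ((volume : Measure (EuclideanSpace ℝ (Fin N))).restrict K) :=
    isFiniteMeasure_restrict.2 hK.measure_ne_top
  rw [restrict_cylinder]
  infer_instance

lemma integrable_abs_rpow_of_memLp {Z : Type*} [MeasurableSpace Z] {μ : Measure Z} {f : Z → ℝ}
    {p : ℝ} (hp : 0 < p) (hf : MemLp f (ENNReal.ofReal p) μ) :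
    Integrable (fun z => |f z| ^ p) μ := by
  have h := hf.integrable_norm_rpow (by simpa using hp) ENNReal.ofReal_ne_top
  rwa [ENNReal.toReal_ofReal hp.le] at h

/-- On compact subsets of `Ω`, outside a null set of times, the increments of a weak solution in
`L ^ (1 / α + 1)` are bounded by the increments of a continuous function of time. -/
lemma IsWeakSolution.exists_modulus {Ω : Set (EuclideanSpace ℝ (Fin N))} (hΩ : IsOpen Ω)
    {T : ℝ} (hT : 0 < T) {α : ℝ} (hα : α ∈ Ioo (0 : ℝ) 1) {p : Fin N → ℝ} (hp : ∀ i, 1 < p i)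
    {Λ : ℝ} (hΛ : 0 < Λ)
    {A : EuclideanSpace ℝ (Fin N) → ℝ → ℝ → EuclideanSpace ℝ (Fin N) → EuclideanSpace ℝ (Fin N)}
    (hA : IsCaratheodory Ω T A) (hAstruct : StructureConditions Ω T Λ p A)
    {u : EuclideanSpace ℝ (Fin N) × ℝ → ℝ} (hu : IsWeakSolution Ω T α p A u)
    {C : Set (EuclideanSpace ℝ (Fin N))} (hC : IsCompact C) (hCΩ : C ⊆ Ω) :
    ∃ (S : Set ℝ) (M : ℝ → ℝ), (∀ᵐ t ∂(volume.restrict (Ioo 0 T)), t ∈ S) ∧ S ⊆ Ioo 0 T ∧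
      ContinuousOn M (Icc 0 T) ∧
      (∀ t ∈ S, MemLp (fun x => signedPow α (u (x, t))) (ENNReal.ofReal (1 / α + 1))
        (volume.restrict C)) ∧
      ∀ s ∈ S, ∀ t ∈ S, s < t →
        ∫ x in C, |signedPow α (u (x, t)) - signedPow α (u (x, s))| ^ (1 / α + 1)
          ≤ M t - M s := by
  obtain ⟨G, hG, huP, hweak⟩ := hu
  obtain ⟨hα0, hα1⟩ := hα
  set q : ℝ := 1 / α + 1 with hqdef
  have hq : 2 ≤ q := by
    have : 1 ≤ 1 / α := by rw [le_div_iff₀ hα0]; linarith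
    linarith
  have hq0 : (0 : ℝ) < q := by linarith
  have hq1 : q - 1 = 1 / α := by rw [hqdef]; ring
  have hrq : (α + 1).HolderConjugate q := by
    rw [Real.holderConjugate_iff]
    refine ⟨by linarith, ?_⟩
    rw [hqdef]
    field_simp
    ring
  -- a cutoff function, and a compact neighbourhood of its support
  obtain ⟨η, hη, hηc, hηΩ, hη1, hη01⟩ := exists_smooth_cutoff hΩ hC hCΩ
  obtain ⟨δ, hδ, hδΩ⟩ := IsCompact.exists_cthickening_subset_open hηc hΩ hηΩ
  set K : Set (EuclideanSpace ℝ (Fin N)) := Metric.cthickening δ (tsupport η) with hKdef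
  have hK : IsCompact K := IsCompact.cthickening hηc
  have hηK : tsupport η ⊆ K := Metric.self_subset_cthickening _
  have hCK : C ⊆ K := fun x hx => hηK (subset_tsupport η (by simp [hη1 x hx]))
  have hη0 : ∀ x, x ∉ K → η x = 0 := fun x hx =>
    image_eq_zero_of_notMem_tsupport fun h => hx (hηK h)
  have hηd0 : ∀ x, x ∉ K → fderiv ℝ η x = 0 := fun x hx =>
    image_eq_zero_of_notMem_tsupport fun h => hx (hηK (tsupport_fderiv_subset ℝ h))
  have hηd : Continuous (fderiv ℝ η) := hη.continuous_fderiv (by norm_cast)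
  obtain ⟨Cη, hCη⟩ := hηd.bounded_above_of_compact_support (hηc.fderiv ℝ)
  set μ : Measure (EuclideanSpace ℝ (Fin N) × ℝ) := volume.restrict (cylinder K T) with hμ
  have hμfin : IsFiniteMeasure μ := isFiniteMeasure_restrict_cylinder hK T
  have hμprod : μ = (volume.restrict K).prod (volume.restrict (Ioo 0 T)) := restrict_cylinder K T
  have hsubΩ : cylinder K T ⊆ cylinder Ω T := prod_mono hδΩ subset_rfl
  -- integrability of the solution and its gradient
  have huα : MemLp u (ENNReal.ofReal (α + 1)) μ :=
    (huP K hδΩ hK).mono_exponent (ENNReal.ofReal_le_ofReal (le_max_left _ _))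
  have hup : ∀ i, MemLp u (ENNReal.ofReal (p i)) μ := fun i =>
    (huP K hδΩ hK).mono_exponent (ENNReal.ofReal_le_ofReal
      ((le_ciSup (Set.finite_range p).bddAbove i).trans (le_max_right _ _)))
  have hGp : ∀ i, MemLp (fun z => G z i) (ENNReal.ofReal (p i)) μ := fun i =>
    hG.memLp_grad i K hδΩ hK
  have hp1 : ∀ i, (1 : ENNReal) ≤ ENNReal.ofReal (p i) := fun i => by
    rw [← ENNReal.ofReal_one]
    exact ENNReal.ofReal_le_ofReal (hp i).le
  have hum : AEStronglyMeasurable u μ := huα.1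
  have hui : Integrable u μ := huα.integrable (by
    rw [← ENNReal.ofReal_one]
    exact ENNReal.ofReal_le_ofReal (by linarith))
  have huαi : Integrable (fun z => |u z| ^ (α + 1)) μ :=
    integrable_abs_rpow_of_memLp (by linarith) huα
  have hGm : AEStronglyMeasurable G μ := by
    have h1 : AEMeasurable (fun z i => G z i) μ :=
      aemeasurable_pi_iff.2 fun i => (hGp i).1.aemeasurable
    exact ((PiLp.continuous_toLp 2 _).measurable.comp_aemeasurable h1).aestronglyMeasurable
  -- the power `w` of the solution and the flux `F`
  set w : EuclideanSpace ℝ (Fin N) × ℝ → ℝ := fun z => signedPow α (u z) with hw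
  have hwq : ∀ z, |w z| ^ q = |u z| ^ (α + 1) := fun z => by
    rw [hw]
    simp only
    rw [abs_signedPow hα0, ← Real.rpow_mul (abs_nonneg _)]
    congr 1
    rw [hqdef]
    field_simp
    ring
  have hwm : AEStronglyMeasurable w μ :=
    ((measurable_signedPow α).comp_aemeasurable hum.aemeasurable).aestronglyMeasurable
  have hwi : Integrable w μ := by
    refine ((integrable_const (1 : ℝ)).add huαi).mono' hwm (ae_of_all _ fun z => ?_)
    have h := abs_mul_le_rpow_add_rpow hrq 1 (w z)
    rw [one_mul, abs_one, Real.one_rpow, hwq] at h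
    exact h
  set F : Fin N → EuclideanSpace ℝ (Fin N) × ℝ → ℝ := fun i z => A z.1 z.2 (u z) (G z) i with hF
  set Gp : EuclideanSpace ℝ (Fin N) × ℝ → ℝ := fun z => ∑ k, |G z k| ^ p k with hGpdef
  have hGp0 : ∀ z, 0 ≤ Gp z := fun z =>
    Finset.sum_nonneg fun _ _ => Real.rpow_nonneg (abs_nonneg _) _
  have hGpi : Integrable Gp μ := integrable_finsetSum _ fun i _ =>
    integrable_abs_rpow_of_memLp (by linarith [hp i]) (hGp i)
  have hgrowth : ∀ᵐ z ∂μ, ∀ i, |F i z| ≤ Λ * Gp z ^ ((p i - 1) / p i) := by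
    filter_upwards [ae_restrict_of_ae_restrict_of_subset hsubΩ hAstruct.growth] with z hz i
      using hz _ _ i
  have hFm : ∀ i, AEStronglyMeasurable (F i) μ := fun i => by
    have h1 := aestronglyMeasurable_comp_of_caratheodory (μ := μ)
      (f := fun (z : EuclideanSpace ℝ (Fin N) × ℝ) (y : ℝ × EuclideanSpace ℝ (Fin N)) =>
        A z.1 z.2 y.1 y.2) (g := fun z => (u z, G z))
      (fun y => (hA.measurable y.1 y.2).mono_set hsubΩ)
      (ae_restrict_of_ae_restrict_of_subset hsubΩ hA.continuous) (hum.prodMk hGm)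
    exact (EuclideanSpace.proj (𝕜 := ℝ) i).continuous.comp_aestronglyMeasurable h1
  have hFi : ∀ i, Integrable (F i) μ := fun i => by
    refine ((hGpi.add (integrable_const 1)).const_mul Λ).mono' (hFm i) ?_
    filter_upwards [hgrowth] with z hz
    have h := rpow_conj_mul_abs_le (hGp0 z) (hp i) 1
    rw [abs_one, mul_one, Real.one_rpow] at h
    exact (hz i).trans (mul_le_mul_of_nonneg_left h hΛ.le)
  set D : EuclideanSpace ℝ (Fin N) × ℝ → ℝ := fun z => N * Λ * Gp z with hD
  have hD0 : ∀ z, 0 ≤ D z := fun z => mul_nonneg (by positivity) (hGp0 z)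
  have hDi : Integrable D μ := hGpi.const_mul _
  have hFD : ∀ᵐ z ∂μ, ∀ y : Fin N → ℝ, |∑ i, F i z * y i| ≤ D z + Λ * ∑ i, |y i| ^ p i := by
    filter_upwards [hgrowth] with z hz y
      using abs_sum_mul_le_of_growth hΛ.le (hGp0 z) hp hz
  -- the gradient `U` of the truncated solution
  set U : Fin N → EuclideanSpace ℝ (Fin N) × ℝ → ℝ := fun i z =>
    η z.1 * G z i + fderiv ℝ η z.1 (EuclideanSpace.single i 1) * u z with hU
  have hUp : ∀ i, MemLp (U i) (ENNReal.ofReal (p i)) μ := fun i => by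
    have hd : Continuous fun z : EuclideanSpace ℝ (Fin N) × ℝ =>
        fderiv ℝ η z.1 (EuclideanSpace.single i 1) := by fun_prop
    have hc : Continuous fun z : EuclideanSpace ℝ (Fin N) × ℝ => η z.1 :=
      hη.continuous.comp continuous_fst
    refine MemLp.add ((hGp i).of_le_mul (c := 1)
      (hc.aestronglyMeasurable.mul (hGp i).1) (ae_of_all _ fun z => ?_))
      ((hup i).of_le_mul (c := Cη) (hd.aestronglyMeasurable.mul hum) (ae_of_all _ fun z => ?_))
    · rw [norm_mul]
      refine mul_le_mul_of_nonneg_right ?_ (norm_nonneg _)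
      rw [Real.norm_of_nonneg (hη01 z.1).1]
      exact (hη01 z.1).2
    · rw [norm_mul]
      refine mul_le_mul_of_nonneg_right ?_ (norm_nonneg _)
      refine (ContinuousLinearMap.le_opNorm _ _).trans ?_
      simpa using hCη z.1
  have hUi : ∀ i, Integrable (U i) μ := fun i => (hUp i).integrable (hp1 i)
  have hUpi : ∀ i, Integrable (fun z => |U i z| ^ p i) μ := fun i =>
    integrable_abs_rpow_of_memLp (by linarith [hp i]) (hUp i)
  -- good times
  obtain ⟨S₁, hS₁, hS₁T, htwo⟩ := exists_ae_forall_two_times hΩ hT hK hδΩ hwi hFi hweak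
  have hsec : ∀ f : EuclideanSpace ℝ (Fin N) × ℝ → ℝ, Integrable f μ →
      ∀ᵐ t ∂(volume.restrict (Ioo 0 T)), Integrable (fun x => f (x, t)) (volume.restrict K) :=
    fun f hf => by
      rw [hμprod] at hf
      exact hf.prod_left_ae
  set S : Set ℝ := {t | t ∈ S₁ ∧ HasWeakGradient Ω (fun x => u (x, t)) (fun x => G (x, t)) ∧
    Integrable (fun x => u (x, t)) (volume.restrict K) ∧
    Integrable (fun x => |u (x, t)| ^ (α + 1)) (volume.restrict K) ∧
    (∀ i, Integrable (fun x => U i (x, t)) (volume.restrict K)) ∧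
    ∀ i, Integrable (fun x => |U i (x, t)| ^ p i) (volume.restrict K)} with hS
  have hSae : ∀ᵐ t ∂(volume.restrict (Ioo 0 T)), t ∈ S := by
    filter_upwards [hS₁, hG.weakGradient, hsec _ hui, hsec _ huαi,
      ae_all_iff.2 fun i => hsec _ (hUi i), ae_all_iff.2 fun i => hsec _ (hUpi i)]
      with t h1 h2 h3 h4 h5 h6 using ⟨h1, h2, h3, h4, h5, h6⟩
  have hST : S ⊆ Ioo 0 T := fun t ht => hS₁T ht.1
  -- the density `m` and its primitive
  set m : ℝ → ℝ := fun t => (∫ x in K, D (x, t)) + Λ * ∑ i, ∫ x in K, |U i (x, t)| ^ p i with hm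
  have hm0 : ∀ t, 0 ≤ m t := fun t => add_nonneg (integral_nonneg fun x => hD0 _)
    (mul_nonneg hΛ.le (Finset.sum_nonneg fun i _ => integral_nonneg fun x =>
      Real.rpow_nonneg (abs_nonneg _) _))
  have hDt : IntegrableOn (fun t => ∫ x in K, D (x, t)) (Ioo 0 T) := by
    rw [hμprod] at hDi
    exact hDi.integral_prod_right
  have hmi : IntegrableOn m (Ioo 0 T) := by
    refine hDt.add ((integrable_finsetSum _ fun i _ => ?_).const_mul Λ)
    have := hUpi i
    rw [hμprod] at this
    exact this.integral_prod_right
  have hint : ∀ f : ℝ → ℝ, IntegrableOn f (Ioo 0 T) → ∀ c d, 0 ≤ c → c ≤ d → d ≤ T →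
      IntervalIntegrable f volume c d := fun f hf c d hc hcd hd => by
    rw [intervalIntegrable_iff_integrableOn_Ioo_of_le hcd]
    exact hf.mono_set (Ioo_subset_Ioo hc hd)
  set M : ℝ → ℝ := fun t => ∫ τ in (0 : ℝ)..t, m τ with hM
  have hMsub : ∀ c d, 0 ≤ c → c ≤ d → d ≤ T → M d - M c = ∫ τ in c..d, m τ :=
    fun c d hc hcd hd => intervalIntegral.integral_interval_sub_left
      (hint m hmi 0 d le_rfl (hc.trans hcd) hd) (hint m hmi 0 c le_rfl hc (hcd.trans hd))
  have hMc : ContinuousOn M (Icc 0 T) := by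
    have h := intervalIntegral.continuousOn_primitive_interval (f := m) (a := 0) (b := T)
      (μ := volume) (by
        rw [uIcc_of_le hT.le, integrableOn_Icc_iff_integrableOn_Ioo]
        exact hmi)
    rwa [uIcc_of_le hT.le] at h
  have hsel : ∀ c d, 0 ≤ c → c < d → d ≤ T →
      ∃ r ∈ S, c < r ∧ r < d ∧ (d - c) * m r ≤ M d - M c := fun c d hc hcd hd => by
    rw [hMsub c d hc hcd.le hd]
    exact exists_mem_mul_le_integral hSae hmi hc hcd hd
  have hwtm : ∀ t ∈ S, AEStronglyMeasurable (fun x => w (x, t)) (volume.restrict K) :=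
    fun t ht => ((measurable_signedPow α).comp_aemeasurable
      ht.2.2.1.aestronglyMeasurable.aemeasurable).aestronglyMeasurable
  have hwtq : ∀ t ∈ S, Integrable (fun x => |w (x, t)| ^ q) (volume.restrict K) :=
    fun t ht => by
      simp only [hwq]
      exact ht.2.2.2.1
  -- the energy estimate between two times
  have hkey : ∀ s ∈ S, ∀ t ∈ S, s < t → ∀ r ∈ S,
      |∫ x in K, (η x * u (x, r)) * (w (x, t) - w (x, s))| ≤ M t - M s + (t - s) * m r := by
    intro s hs t ht hst r hr
    have hs0 := (hST hs).1
    have htT := (hST ht).2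
    have hsubI : K ×ˢ Ioo s t ⊆ cylinder K T :=
      prod_mono subset_rfl (Ioo_subset_Ioo hs0.le htT.le)
    obtain ⟨-, hr1, hr2, hr3, hr4, hr5⟩ := hr
    have hsupp : ∀ f : EuclideanSpace ℝ (Fin N) → ℝ, (∀ x, x ∉ K → f x = 0) →
        Integrable f (volume.restrict K) → Integrable f := fun f hf0 hf => by
      rwa [← integrableOn_iff_integrable_of_support_subset (s := K)]
      intro x hx
      by_contra h
      exact hx (hf0 x h)
    have hU0 : ∀ i x, x ∉ K → U i (x, r) = 0 := fun i x hx => by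
      simp [hU, hη0 x hx, hηd0 x hx]
    have hp0 : ∀ i, p i ≠ 0 := fun i => by linarith [hp i]
    have hbase := abs_setIntegral_mul_le_of_two_times hp hΛ.le hδ hηc (hKdef ▸ subset_rfl) hrq hst
      (F := F) (D := D) (W := fun x => w (x, t) - w (x, s))
      (v := fun x => η x * u (x, r)) (U := fun i x => U i (x, r))
      (ae_restrict_of_ae_restrict_of_subset hsubI hFD) (hDi.mono_measure
        (Measure.restrict_mono hsubI le_rfl)) ((hwtm t ht).sub (hwtm s hs))
      (by
        have h1 : MemLp (fun x => w (x, t)) (ENNReal.ofReal q) (volume.restrict K) := by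
          rw [← integrable_norm_rpow_iff (hwtm t ht) (by simpa using hq0) ENNReal.ofReal_ne_top,
            ENNReal.toReal_ofReal hq0.le]
          exact hwtq t ht
        have h2 : MemLp (fun x => w (x, s)) (ENNReal.ofReal q) (volume.restrict K) := by
          rw [← integrable_norm_rpow_iff (hwtm s hs) (by simpa using hq0) ENNReal.ofReal_ne_top,
            ENNReal.toReal_ofReal hq0.le]
          exact hwtq s hs
        exact integrable_abs_rpow_of_memLp hq0 (h1.sub h2))
      (htwo s hs.1 t ht.1 hst)
      (fun x hx => subset_tsupport η (left_ne_zero_of_mul hx))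
      (hsupp _ (fun x hx => by simp [hη0 x hx])
        (hr2.bdd_mul (c := 1) hη.continuous.aestronglyMeasurable (ae_of_all _ fun x => by
          rw [Real.norm_of_nonneg (hη01 x).1]; exact (hη01 x).2)))
      (hsupp _ (fun x hx => by
          rw [hη0 x hx, zero_mul, abs_zero, Real.zero_rpow (by linarith)])
        (hr3.mono' ((hη.continuous.aestronglyMeasurable.mul
          hr2.aestronglyMeasurable).aemeasurable.abs.pow_const _).aestronglyMeasurable
          (ae_of_all _ fun x => by
            rw [Real.norm_of_nonneg (Real.rpow_nonneg (abs_nonneg _) _)]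
            refine Real.rpow_le_rpow (abs_nonneg _) ?_ (by linarith)
            rw [abs_mul, abs_of_nonneg (hη01 x).1]
            exact mul_le_of_le_one_left (abs_nonneg _) (hη01 x).2)))
      (fun i => hsupp _ (hU0 i) (hr4 i))
      (fun i => hsupp _ (fun x hx => by
        rw [hU0 i x hx, abs_zero, Real.zero_rpow (hp0 i)]) (hr5 i))
      (fun i φ hφ _ => hr1.integral_cutoff_mul hη hηc hηΩ i hφ)
    refine hbase.trans ?_
    have hD1 : ∫ z in K ×ˢ Ioo s t, D z ≤ M t - M s := by
      have hDst : IntegrableOn D (K ×ˢ Ioo s t) :=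
        hDi.mono_measure (Measure.restrict_mono hsubI le_rfl)
      rw [IntegrableOn, restrict_prod_Ioo] at hDst
      rw [hMsub s t hs0.le hst.le htT.le, restrict_prod_Ioo, integral_prod_symm _ hDst,
        ← integral_Ioc_eq_integral_Ioo, ← intervalIntegral.integral_of_le hst.le]
      refine intervalIntegral.integral_mono_on hst.le (hint _ hDt s t hs0.le hst.le htT.le)
        (hint m hmi s t hs0.le hst.le htT.le) fun τ _ => ?_
      exact le_add_of_nonneg_right (mul_nonneg hΛ.le (Finset.sum_nonneg fun i _ =>
        integral_nonneg fun x => Real.rpow_nonneg (abs_nonneg _) _))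
    have hU1 : Λ * ∑ i, ∫ x, |U i (x, r)| ^ p i ≤ m r := by
      have h1 : ∀ i, ∫ x, |U i (x, r)| ^ p i = ∫ x in K, |U i (x, r)| ^ p i := fun i => by
        rw [setIntegral_eq_integral_of_forall_compl_eq_zero]
        intro x hx
        rw [hU0 i x hx, abs_zero, Real.zero_rpow (hp0 i)]
      simp only [h1]
      exact le_add_of_nonneg_left (integral_nonneg fun x => hD0 _)
    have h3 := mul_le_mul_of_nonneg_left hU1 (sub_nonneg.2 hst.le)
    rw [mul_assoc]
    linarith
  -- the cutoff as a weight
  set g : EuclideanSpace ℝ (Fin N) → NNReal := fun x => (η x).toNNReal with hg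
  have hgm : Measurable g := hη.continuous.measurable.real_toNNReal
  set ν : Measure (EuclideanSpace ℝ (Fin N)) :=
    (volume.restrict K).withDensity (fun x => g x) with hν
  have hgsmul : ∀ (x : EuclideanSpace ℝ (Fin N)) (a : ℝ), g x • a = η x * a := fun x a => by
    rw [NNReal.smul_def, hg, smul_eq_mul, Real.coe_toNNReal _ (hη01 x).1]
  have hνint : ∀ f : EuclideanSpace ℝ (Fin N) → ℝ, ∫ x, f x ∂ν = ∫ x in K, η x * f x := fun f => by
    rw [hν, integral_withDensity_eq_integral_smul hgm]
    simp only [hgsmul]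
  have hνi : ∀ f : EuclideanSpace ℝ (Fin N) → ℝ, Integrable f (volume.restrict K) →
      Integrable (fun x => η x * f x) (volume.restrict K) := fun f hf =>
    hf.bdd_mul (c := 1) hη.continuous.aestronglyMeasurable (ae_of_all _ fun x => by
      rw [Real.norm_of_nonneg (hη01 x).1]; exact (hη01 x).2)
  have hνac : ν ≪ volume.restrict K := withDensity_absolutelyContinuous _ _
  have hmain : ∀ s ∈ S, ∀ t ∈ S, s < t →
      ∫ x, |w (x, t) - w (x, s)| ^ q ∂ν ≤ 2 * 4 ^ q * q * (M t - M s) := by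
    intro s hs t ht hst
    refine integral_abs_sub_rpow_le_of_energy hq (w := fun t x => w (x, t)) hST hsel hm0
      (fun t ht => (hwtm t ht).mono_ac hνac) (fun t ht => ?_) ?_ hs ht hst
    · rw [hν, integrable_withDensity_iff_integrable_smul hgm]
      simp only [hgsmul]
      exact hνi _ (hwtq t ht)
    · intro s hs t ht hst r hr
      rw [hνint]
      have h1 : ∀ x, η x * (signedPow (q - 1) (w (x, r)) * (w (x, t) - w (x, s)))
          = (η x * u (x, r)) * (w (x, t) - w (x, s)) := fun x => by
        rw [hq1, hw]
        simp only
        rw [signedPow_signedPow_inv hα0, mul_assoc]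
      simp only [h1]
      exact hkey s hs t ht hst r hr
  have hmem : ∀ t ∈ S, MemLp (fun x => w (x, t)) (ENNReal.ofReal q) (volume.restrict K) :=
    fun t ht => by
      rw [← integrable_norm_rpow_iff (hwtm t ht) (by simpa using hq0) ENNReal.ofReal_ne_top,
        ENNReal.toReal_ofReal hq0.le]
      exact hwtq t ht
  refine ⟨S, fun t => 2 * 4 ^ q * q * M t, hSae, hST, continuousOn_const.mul hMc,
    fun t ht => (hmem t ht).mono_measure (Measure.restrict_mono hCK le_rfl), ?_⟩
  intro s hs t ht hst
  have h1 := hmain s hs t ht hst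
  rw [hνint, mul_sub] at h1
  refine le_trans ?_ h1
  have hdi : Integrable (fun x => η x * |w (x, t) - w (x, s)| ^ q) (volume.restrict K) :=
    hνi _ (integrable_abs_rpow_of_memLp hq0 ((hmem t ht).sub (hmem s hs)))
  calc ∫ x in C, |w (x, t) - w (x, s)| ^ q
      = ∫ x in C, η x * |w (x, t) - w (x, s)| ^ q :=
        setIntegral_congr_fun hC.measurableSet fun x hx => by simp only [hη1 x hx, one_mul]
    _ ≤ ∫ x in K, η x * |w (x, t) - w (x, s)| ^ q :=
        setIntegral_mono_set hdi (ae_of_all _ fun x => mul_nonneg (hη01 x).1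
          (Real.rpow_nonneg (abs_nonneg _) _)) hCK.eventuallyLE

end Modulus

/-! ### Continuous extension to the closed time interval -/

lemma Icc_subset_closure_of_ae_mem {S : Set ℝ} {T : ℝ} (hT : 0 < T)
    (hS : ∀ᵐ t ∂(volume.restrict (Ioo 0 T)), t ∈ S) : Icc 0 T ⊆ closure S := by
  intro t ht
  rw [Metric.mem_closure_iff]
  intro ε hε
  obtain ⟨r, hr, h1, h2, -⟩ := exists_mem_mul_le_integral (m := fun _ => 0) hS
    (integrable_zero _ _ _) (le_max_left 0 (t - ε))
    (show max 0 (t - ε) < min T (t + ε) by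
      rw [max_lt_iff, lt_min_iff, lt_min_iff]
      exact ⟨⟨hT, by linarith [ht.1]⟩, by linarith [ht.2], by linarith⟩)
    (min_le_left _ _)
  refine ⟨r, hr, ?_⟩
  rw [max_lt_iff] at h1
  rw [lt_min_iff] at h2
  rw [Real.dist_eq, abs_lt]
  constructor <;> linarith [h1.2, h2.2]

/-- A family of functions, defined for almost every time, whose increments in `L ^ q` are bounded
by those of a continuous function extends continuously to the closed time interval. -/
lemma exists_continuous_extension {X : Type*} [MeasurableSpace X] {ν : Measure X} {q : ℝ}
    (hq : 1 ≤ q) {w : ℝ → X → ℝ} {S : Set ℝ} {M : ℝ → ℝ} {T : ℝ} (hT : 0 < T)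
    (hS : ∀ᵐ t ∂(volume.restrict (Ioo 0 T)), t ∈ S) (hST : S ⊆ Ioo 0 T)
    (hM : ContinuousOn M (Icc 0 T)) (hmem : ∀ t ∈ S, MemLp (w t) (ENNReal.ofReal q) ν)
    (hinc : ∀ s ∈ S, ∀ t ∈ S, s < t → ∫ x, |w t x - w s x| ^ q ∂ν ≤ M t - M s) :
    ∃ L : ℝ → X → ℝ, (∀ t, MemLp (L t) (ENNReal.ofReal q) ν) ∧
      (∀ t₀ ∈ Icc 0 T, Tendsto (fun t => eLpNorm (L t - L t₀) (ENNReal.ofReal q) ν)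
        (𝓝[Icc 0 T] t₀) (𝓝 0)) ∧
      (∀ t₀ ∈ Icc 0 T, Tendsto (fun t => eLpNorm (w t - L t₀) (ENNReal.ofReal q) ν)
        (𝓝[S] t₀) (𝓝 0)) ∧
      ∀ t ∈ S, w t =ᵐ[ν] L t := by
  classical
  have hq0 : 0 < q := by linarith
  have : Fact (1 ≤ ENNReal.ofReal q) := ⟨by
    rw [← ENNReal.ofReal_one]; exact ENNReal.ofReal_le_ofReal hq⟩
  let f : ℝ → Lp ℝ (ENNReal.ofReal q) ν := fun t =>
    if h : t ∈ S then (hmem t h).toLp (w t) else 0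
  have hfS : ∀ t (h : t ∈ S), f t = (hmem t h).toLp (w t) := fun t h => dif_pos h
  have hdist : ∀ s ∈ S, ∀ t ∈ S, s < t → dist (f t) (f s) ≤ |M t - M s| ^ (1 / q) := by
    intro s hs t ht hst
    rw [hfS s hs, hfS t ht, dist_eq_norm, ← MemLp.toLp_sub, Lp.norm_toLp,
      ((hmem t ht).sub (hmem s hs)).eLpNorm_eq_integral_rpow_norm (by simpa using hq0)
        ENNReal.ofReal_ne_top, ENNReal.toReal_ofReal hq0.le, ← one_div]
    have h0 : 0 ≤ ∫ x, ‖(w t - w s) x‖ ^ q ∂ν :=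
      integral_nonneg fun x => Real.rpow_nonneg (norm_nonneg _) _
    rw [ENNReal.toReal_ofReal (Real.rpow_nonneg h0 _)]
    exact Real.rpow_le_rpow h0 ((hinc s hs t ht hst).trans (le_abs_self _)) (by positivity)
  have hdist' : ∀ s ∈ S, ∀ t ∈ S, dist (f s) (f t) ≤ |M s - M t| ^ (1 / q) := by
    intro s hs t ht
    rcases lt_trichotomy s t with h | h | h
    · rw [dist_comm, abs_sub_comm]
      exact hdist s hs t ht h
    · rw [h, dist_self]
      exact Real.rpow_nonneg (abs_nonneg _) _
    · exact hdist t ht s hs h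
  let L : ℝ → Lp ℝ (ENNReal.ofReal q) ν := extendFrom S f
  have hcl := Icc_subset_closure_of_ae_mem hT hS
  have hMS : ∀ t₀ ∈ Icc 0 T, Tendsto M (𝓝[S] t₀) (𝓝 (M t₀)) := fun t₀ ht₀ =>
    (hM t₀ ht₀).mono_left (nhdsWithin_mono _ (hST.trans Ioo_subset_Icc_self))
  have hpow : ∀ {ι : Type} {l : Filter ι} {g : ι → ℝ}, Tendsto g l (𝓝 0) →
      Tendsto (fun i => |g i| ^ (1 / q)) l (𝓝 0) := fun {ι l g} hg => by
    have h := hg.abs.rpow_const (p := 1 / q) (Or.inr (by positivity))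
    rwa [abs_zero, Real.zero_rpow (by positivity)] at h
  have hlim : ∀ t₀ ∈ Icc 0 T, ∃ y, Tendsto f (𝓝[S] t₀) (𝓝 y) := by
    intro t₀ ht₀
    have hne : (𝓝[S] t₀).NeBot := mem_closure_iff_nhdsWithin_neBot.1 (hcl ht₀)
    refine cauchy_map_iff_exists_tendsto.1 (cauchy_map_iff.2 ⟨hne, ?_⟩)
    rw [tendsto_uniformity_iff_dist_tendsto_zero]
    have h1 : Tendsto (fun i : ℝ × ℝ => M i.1 - M i.2) (𝓝[S] t₀ ×ˢ 𝓝[S] t₀) (𝓝 0) := by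
      have h := ((hMS t₀ ht₀).comp tendsto_fst).sub
        ((hMS t₀ ht₀).comp (tendsto_snd (f := 𝓝[S] t₀)))
      simpa using h
    refine squeeze_zero' (Eventually.of_forall fun _ => dist_nonneg) ?_ (hpow h1)
    filter_upwards [prod_mem_prod self_mem_nhdsWithin self_mem_nhdsWithin] with i hi
      using hdist' _ hi.1 _ hi.2
  have hcont : ContinuousOn L (Icc 0 T) := continuousOn_extendFrom hcl hlim
  have hext : ∀ t ∈ S, L t = f t := by
    intro t ht
    have htI := Ioo_subset_Icc_self (hST ht)
    refine extendFrom_eq (hcl htI) ?_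
    rw [tendsto_iff_dist_tendsto_zero]
    have h1 : Tendsto (fun s => M s - M t) (𝓝[S] t) (𝓝 0) := by
      simpa using (hMS t htI).sub_const (M t)
    refine squeeze_zero' (Eventually.of_forall fun _ => dist_nonneg) ?_ (hpow h1)
    filter_upwards [self_mem_nhdsWithin] with s hs using hdist' _ hs _ ht
  have hwL : ∀ t ∈ S, w t =ᵐ[ν] (L t : X → ℝ) := fun t ht => by
    rw [hext t ht, hfS t ht]
    exact (MemLp.coeFn_toLp _).symm
  have htend : ∀ t₀ ∈ Icc 0 T, Tendsto (fun t => eLpNorm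
      ((L t : X → ℝ) - (L t₀ : X → ℝ)) (ENNReal.ofReal q) ν)
        (𝓝[Icc 0 T] t₀) (𝓝 0) := fun t₀ ht₀ => by
    have h := tendsto_iff_edist_tendsto_0.1 (hcont t₀ ht₀)
    simpa only [Lp.edist_def] using h
  refine ⟨fun t => L t, fun t => Lp.memLp _, htend, fun t₀ ht₀ => ?_, hwL⟩
  refine ((htend t₀ ht₀).mono_left
    (nhdsWithin_mono _ (hST.trans Ioo_subset_Icc_self))).congr' ?_
  filter_upwards [self_mem_nhdsWithin] with t ht
  exact eLpNorm_congr_ae ((hwL t ht).symm.sub EventuallyEq.rfl)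

lemma ae_eq_of_tendsto_eLpNorm_sub {X ι : Type*} [MeasurableSpace X] {ν : Measure X} {q : ENNReal}
    (hq : 1 ≤ q) {l : Filter ι} [l.NeBot] {w : ι → X → ℝ} {f g : X → ℝ}
    (hw : ∀ᶠ i in l, AEStronglyMeasurable (w i) ν) (hf : AEStronglyMeasurable f ν)
    (hg : AEStronglyMeasurable g ν) (h1 : Tendsto (fun i => eLpNorm (w i - f) q ν) l (𝓝 0))
    (h2 : Tendsto (fun i => eLpNorm (w i - g) q ν) l (𝓝 0)) : f =ᵐ[ν] g := by
  have h3 : eLpNorm (f - g) q ν ≤ 0 := by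
    have h4 := h1.add h2
    rw [add_zero] at h4
    refine ge_of_tendsto h4 ?_
    filter_upwards [hw] with i hi
    have h5 : f - g = (f - w i) + (w i - g) := by abel
    rw [h5, ← eLpNorm_sub_comm f (w i)]
    exact eLpNorm_add_le (hf.sub hi) (hi.sub hg) hq
  have h6 := (eLpNorm_eq_zero_iff (hf.sub hg) (by positivity)).1 (le_antisymm h3 zero_le)
  filter_upwards [h6] with x hx
  exact sub_eq_zero.1 hx

/-- An open set is exhausted by an increasing sequence of compact sets which absorbs all its
compact subsets. -/
lemma IsOpen.exists_compact_exhaustion {X : Type*} [TopologicalSpace X] [LocallyCompactSpace X]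
    [SecondCountableTopology X] {Ω : Set X} (hΩ : IsOpen Ω) :
    ∃ K : ℕ → Set X, Monotone K ∧ (∀ n, IsCompact (K n)) ∧ (∀ n, K n ⊆ Ω) ∧
      ∀ C ⊆ Ω, IsCompact C → ∃ n, C ⊆ K n := by
  have : LocallyCompactSpace Ω := hΩ.locallyCompactSpace
  let E : CompactExhaustion Ω := CompactExhaustion.choice Ω
  refine ⟨fun n => Subtype.val '' E n, fun m n h => image_mono (E.subset h),
    fun n => (E.isCompact n).image continuous_subtype_val, fun n => ?_, fun C hC hCc => ?_⟩
  · rintro _ ⟨x, -, rfl⟩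
    exact x.2
  · have h1 : IsCompact (Subtype.val ⁻¹' C : Set Ω) := by
      rw [Subtype.isCompact_iff, Subtype.image_preimage_coe, inter_eq_right.2 hC]
      exact hCc
    obtain ⟨n, hn⟩ := E.exists_superset_of_isCompact h1
    exact ⟨n, fun x hx => ⟨⟨x, hC hx⟩, hn hx, rfl⟩⟩

/-- A function whose increments in time are controlled, on every compact set, by those of a
continuous function has a representative in `C([0, T]; L ^ q_loc)`: the extensions over an
exhausting sequence of compact sets agree on overlaps. -/
lemma memContLpLoc_of_modulus {N : ℕ} {Ω : Set (EuclideanSpace ℝ (Fin N))} (hΩ : IsOpen Ω)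
    {T : ℝ} (hT : 0 < T) {q : ℝ} (hq : 1 ≤ q) {f : EuclideanSpace ℝ (Fin N) × ℝ → ℝ}
    (h : ∀ C : Set (EuclideanSpace ℝ (Fin N)), IsCompact C → C ⊆ Ω →
      ∃ (S : Set ℝ) (M : ℝ → ℝ), (∀ᵐ t ∂(volume.restrict (Ioo 0 T)), t ∈ S) ∧ S ⊆ Ioo 0 T ∧
        ContinuousOn M (Icc 0 T) ∧
        (∀ t ∈ S, MemLp (fun x => f (x, t)) (ENNReal.ofReal q) (volume.restrict C)) ∧
        ∀ s ∈ S, ∀ t ∈ S, s < t → ∫ x in C, |f (x, t) - f (x, s)| ^ q ≤ M t - M s) :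
    MemContLpLoc Ω T q f := by
  classical
  obtain ⟨K, hKmono, hKc, hKΩ, hKabs⟩ := hΩ.exists_compact_exhaustion
  choose S' M hS' hS'T hM hmem hinc using fun n => h (K n) (hKc n) (hKΩ n)
  set S : Set ℝ := ⋂ n, S' n with hSdef
  have hS : ∀ᵐ t ∂(volume.restrict (Ioo 0 T)), t ∈ S := by
    filter_upwards [ae_all_iff.2 hS'] with t ht using mem_iInter.2 ht
  have hSS : ∀ n, S ⊆ S' n := fun n => iInter_subset _ n
  have hST : S ⊆ Ioo 0 T := (hSS 0).trans (hS'T 0)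
  choose L hLmem hLcont hLlim hLS using fun n =>
    exists_continuous_extension (ν := volume.restrict (K n)) (w := fun t x => f (x, t)) hq hT hS hST
      (hM n) (fun t ht => hmem n t (hSS n ht))
      (fun s hs t ht hst => hinc n s (hSS n hs) t (hSS n ht) hst)
  have hq1 : (1 : ENNReal) ≤ ENNReal.ofReal q := by
    rw [← ENNReal.ofReal_one]; exact ENNReal.ofReal_le_ofReal hq
  have hcompat : ∀ t ∈ Icc 0 T, ∀ n, ∀ m ≤ n, L m t =ᵐ[volume.restrict (K m)] L n t := by
    intro t ht n m hmn
    have hne : (𝓝[S] t).NeBot :=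
      mem_closure_iff_nhdsWithin_neBot.1 (Icc_subset_closure_of_ae_mem hT hS ht)
    have hle : volume.restrict (K m) ≤ volume.restrict (K n) :=
      Measure.restrict_mono (hKmono hmn) le_rfl
    refine ae_eq_of_tendsto_eLpNorm_sub hq1 (l := 𝓝[S] t) (w := fun s x => f (x, s)) ?_
      (hLmem m t).1 ((hLmem n t).1.mono_measure hle) (hLlim m t ht)
      (tendsto_of_tendsto_of_tendsto_of_le_of_le tendsto_const_nhds (hLlim n t ht)
        (fun _ => zero_le) fun s => eLpNorm_mono_measure _ hle)
    filter_upwards [self_mem_nhdsWithin] with s hs using (hmem m s (hSS m hs)).1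
  let v : ℝ → EuclideanSpace ℝ (Fin N) → ℝ := fun t x =>
    if t ∈ S then f (x, t) else if hx : ∃ n, x ∈ K n then L (Nat.find hx) t x else 0
  have hv : ∀ t ∈ Icc 0 T, ∀ n, v t =ᵐ[volume.restrict (K n)] L n t := by
    intro t ht n
    by_cases htS : t ∈ S
    · filter_upwards [hLS n t htS] with x hx
      simp only [v, if_pos htS, hx]
    · have hall : ∀ᵐ x, ∀ m, m ≤ n → x ∈ K m → L m t x = L n t x := by
        refine ae_all_iff.2 fun m => ?_
        by_cases hmn : m ≤ n
        · filter_upwards [(ae_restrict_iff' (hKc m).measurableSet).1 (hcompat t ht n m hmn)]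
            with x hx _ hxm using hx hxm
        · exact ae_of_all _ fun x h => absurd h hmn
      filter_upwards [ae_restrict_of_ae hall, ae_restrict_mem (hKc n).measurableSet] with x hx hxn
      have hex : ∃ n, x ∈ K n := ⟨n, hxn⟩
      simp only [v, if_neg htS, dif_pos hex]
      exact hx _ (Nat.find_min' hex hxn) (Nat.find_spec hex)
  refine ⟨v, fun C hCΩ hC => ?_, ?_⟩
  · obtain ⟨n, hn⟩ := hKabs C hCΩ hC
    have hle : volume.restrict C ≤ volume.restrict (K n) := Measure.restrict_mono hn le_rfl
    refine ⟨fun t ht => ((hLmem n t).ae_eq (hv t ht n).symm).mono_measure hle, fun t₀ ht₀ => ?_⟩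
    refine tendsto_of_tendsto_of_tendsto_of_le_of_le' tendsto_const_nhds (hLcont n t₀ ht₀)
      (Eventually.of_forall fun _ => zero_le) ?_
    filter_upwards [self_mem_nhdsWithin] with t ht
    refine (eLpNorm_mono_measure _ hle).trans (le_of_eq ?_)
    exact eLpNorm_congr_ae ((hv t ht n).sub (hv t₀ ht₀ n))
  · rw [restrict_cylinder]
    filter_upwards [Measure.quasiMeasurePreserving_snd.ae hS] with z hz
    simp only [v, if_pos hz]

theorem mainTheorem4 (N : ℕ) (hN : 1 ≤ N) (Ω : Set (EuclideanSpace ℝ (Fin N))) (hΩ : IsOpen Ω)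
    (T : ℝ) (hT : 0 < T) (α : ℝ) (hα : α ∈ Set.Ioo (0 : ℝ) 1)
    (p : Fin N → ℝ) (hp : ∀ i, 1 < p i) (Λ : ℝ) (hΛ : 0 < Λ)
    (A : EuclideanSpace ℝ (Fin N) → ℝ → ℝ → EuclideanSpace ℝ (Fin N) →
      EuclideanSpace ℝ (Fin N))
    (hA : IsCaratheodory Ω T A) (hAstruct : StructureConditions Ω T Λ p A)
    (u : EuclideanSpace ℝ (Fin N) × ℝ → ℝ) (hu : IsWeakSolution Ω T α p A u) :
    MemContLpLoc Ω T (1 / α + 1) (fun z => signedPow α (u z)) := by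
  have hq : 1 ≤ 1 / α + 1 := le_add_of_nonneg_left (one_div_nonneg.2 hα.1.le)
  exact memContLpLoc_of_modulus hΩ hT hq fun C hC hCΩ =>
    hu.exists_modulus hΩ hT hα hp hΛ hA hAstruct hC hCΩ
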